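/- For $d\in\{1,2,3,\dots\}$ and $t>0$ let $B_t=\{x\in\mathbb R^d: |x|\le t\}$ be the closed Euclidean ball, and for $f:\mathbb Z^d\to\mathbb C$ put $$\mathcal M_t f(x)=\frac{1}{|B_t\cap\mathbb Z^d|}\sum_{y\in B_t\cap\mathbb Z^d} f(x-y),\qquad x\in\mathbb Z^d.$$ Let $\mathbb D=\{2^n: n=0,1,2,\dots\}$, let $C_0>0$, and let $\mathbb D_{C_0}=\{N\in\mathbb D: 1\le N\le C_0 d^{1/2}\}$. Then there is a constant $C>0$, which may depend on $C_0$ but not on the dimension $d$, such that for every $d\ge 1$ and every $f\in\ell^2(\mathbb Z^d)$ one has $$\Big\|\sup_{N\in\mathbb D_{C_0}}|\mathcal M_N f|\Big\|_{\ell^2(\mathbb Z^d)}\le C\,\|f\|_{\ell^2(\mathbb Z^d)}.$$ (If $\mathbb D_{C_0}$ is empty, the supremum is read as $0$.) -/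

import Mathlib

noncomputable section

/-- A lattice point `x ∈ ℤ^d`, seen as a point of Euclidean space `ℝ^d`. -/
def latticePoint {d : ℕ} (x : Fin d → ℤ) : EuclideanSpace ℝ (Fin d) :=
  WithLp.toLp 2 (fun i => (x i : ℝ))

theorem latticeBall_finite (d : ℕ) (t : ℝ) :
    {x : Fin d → ℤ | latticePoint x ∈ Metric.closedBall (0 : EuclideanSpace ℝ (Fin d)) t}.Finite := by
  refine (Set.Finite.pi (fun _ : Fin d => Set.finite_Icc (-⌈t⌉) ⌈t⌉)).subset ?_
  intro x hx i _
  have h1 : ‖latticePoint x‖ ≤ t := by simpa using hx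
  have h2 : |(x i : ℝ)| ≤ t := by
    have := (PiLp.norm_apply_le (latticePoint x) i).trans h1
    simpa [latticePoint] using this
  have h3 := abs_le.1 (h2.trans (Int.le_ceil t))
  exact ⟨by exact_mod_cast h3.1, by exact_mod_cast h3.2⟩

/-- `B_t ∩ ℤ^d`: the lattice points of the closed Euclidean ball of radius `t` centred at `0`. -/
def latticeBall (d : ℕ) (t : ℝ) : Finset (Fin d → ℤ) :=
  (latticeBall_finite d t).toFinset

/-- The discrete Hardy–Littlewood averaging operator
`𝓜_t f(x) = |B_t ∩ ℤ^d|⁻¹ ∑_{y ∈ B_t ∩ ℤ^d} f(x - y)`. -/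
def discreteAvg {d : ℕ} (t : ℝ) (f : (Fin d → ℤ) → ℂ) (x : Fin d → ℤ) : ℂ :=
  ((latticeBall d t).card : ℂ)⁻¹ * ∑ y ∈ latticeBall d t, f (x - y)

/-- The set of dyadic numbers `𝔻 = {2^n : n = 0, 1, 2, …}`. -/
def dyadic : Set ℝ := {N | ∃ n : ℕ, N = 2 ^ n}

/-- The small scales: `{N ∈ 𝔻 : 1 ≤ N ≤ C₀ d^{1/2}}`. -/
def smallScales (C₀ : ℝ) (d : ℕ) : Set ℝ :=
  {N | N ∈ dyadic ∧ 1 ≤ N ∧ N ≤ C₀ * Real.sqrt d}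

/-- The maximal function `x ↦ sup_N |𝓜_N f(x)|` over the small scales. This is a supremum over a
finite set of scales; if there are none, its value is `0`. -/
def smallScaleMaximal {d : ℕ} (C₀ : ℝ) (f : (Fin d → ℤ) → ℂ) (x : Fin d → ℤ) : ℝ :=
  ⨆ N : smallScales C₀ d, ‖discreteAvg (N : ℝ) f x‖

end

/-!
The ball averages are compared, scale by scale, with ergodic means of the nearest neighbour random
walk `T` on `ℤ^d`, whose symbol is `q = 1 - 2 u` with `u = energy θ = d⁻¹ ∑ sin² (θⱼ / 2)`. Put
`N = 2 ^ j` and `n = N² = 4 ^ j`. Only boundedly many scales satisfy `512 n > d` and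
`N ≤ C₀ d ^ (1 / 2)` (`card_large_scales_le`), and each of these averages is a contraction; so it may
be assumed that `512 n ≤ d`.

The multiplier `m` of the ball average is the mean over the points `x` of the ball of
`∏ cos (xⱼ θⱼ)`. By permutation invariance the mean of `xⱼ²` is at most `n / d`, whence
`|m - 1| ≤ 2 n u` (`abs_cosMean_sub_le`). In the other direction, if at least half of the cosines
`cos θⱼ` are nonnegative, then `|m| ≤ C / (n u)` (`abs_cosMean_mul_le`). Indeed, since `n` is small
compared to `d`, all but a fraction `2 ^ (-n)` of the points have at least `n / 4` coordinates `±1`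
and even more vanishing ones (`card_few_units_mul_le`). Exchanging each such unit coordinate with a
vanishing one turns the product of cosines into a product of means `(cos θᵢ + cos θₖ) / 2` over
random disjoint pairs (`abs_expect_perm_prod_cos_le`), and a second moment computation shows that
this product is small (`mul_expect_perm_prod_le`).

If more than half of the cosines are negative, `θ` is shifted by `(π, …, π)`. This multiplies the
product of cosines by the parity character, which is permutation invariant, so the same two
estimates hold with `1` replaced by the mean parity `ε` of the ball and `u` by `1 - u`. In both
cases `m` differs from the symbol of `n⁻¹ ∑_{k < n} (1 + ε (-1)ᵏ) Tᵏ` by a quantity whose squares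
are summable over `n = 4 ^ j`, uniformly in `θ` and `d` (`exists_abs_multiplier_sub_le`). By
Plancherel the maximal function of the differences is bounded on `ℓ²`.

The model operators are dominated pointwise by twice the ergodic means of `T`, and the maximal
function of these has norm at most `2` on `ℓ²` by Hopf's maximal ergodic theorem
(`IsMarkov.sum_ergodicMax_sq_le`), whatever the dimension.
-/

open scoped BigOperators

/-! ### Averages over commuting involutions and over permutations -/

/-- A sum over a set that is stable under commuting involutions `e s` does not change when each
factor `f s`, which only `e s` moves, is replaced by its mean over the orbit of `e s`. -/
theorem sum_prod_eq_sum_prod_mean {X ι K : Type*} [Field K] [CharZero K]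
    (Ω : Finset X) (e : ι → X → X) (f f' : ι → X → K)
    (hΩ : ∀ s, ∀ x ∈ Ω, e s x ∈ Ω) (hinv : ∀ s x, e s (e s x) = x)
    (hf : ∀ s x, f s (e s x) = f' s x)
    (hf₁ : ∀ s t x, t ≠ s → f s (e t x) = f s x)
    (hf₂ : ∀ s t x, t ≠ s → f' s (e t x) = f' s x)
    (S : Finset ι) (R : X → K) (hR : ∀ s ∈ S, ∀ x, R (e s x) = R x) :
    ∑ x ∈ Ω, (∏ s ∈ S, f s x) * R x = ∑ x ∈ Ω, (∏ s ∈ S, (f s x + f' s x) / 2) * R x := by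
  classical
  induction S using Finset.induction_on generalizing R with
  | empty => simp
  | insert a S ha ih =>
    have hne : ∀ s ∈ S, s ≠ a := fun s hs h => ha (h ▸ hs)
    have h1 := ih (fun x => f a x * R x) (fun s hs x => by
      rw [hf₁ a s x (hne s hs), hR s (Finset.mem_insert_of_mem hs) x])
    have h2 : ∑ x ∈ Ω, (∏ s ∈ S, (f s x + f' s x) / 2) * (f a x * R x)
        = ∑ x ∈ Ω, (∏ s ∈ S, (f s x + f' s x) / 2) * (f' a x * R x) := by
      refine Finset.sum_nbij' (e a) (e a) (hΩ a) (hΩ a) (fun x _ => hinv a x)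
        (fun x _ => hinv a x) (fun x _ => ?_)
      have hp : ∏ s ∈ S, (f s (e a x) + f' s (e a x)) / 2 = ∏ s ∈ S, (f s x + f' s x) / 2 :=
        Finset.prod_congr rfl fun s hs => by
          rw [hf₁ s a x (hne s hs).symm, hf₂ s a x (hne s hs).symm]
      have hf' : f' a (e a x) = f a x := by rw [← hf a (e a x), hinv]
      rw [hp, hf', hR a (Finset.mem_insert_self a S) x]
    have h3 : ∑ x ∈ Ω, (∏ s ∈ insert a S, f s x) * R x
        = ∑ x ∈ Ω, (∏ s ∈ S, f s x) * (f a x * R x) :=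
      Finset.sum_congr rfl fun x _ => by rw [Finset.prod_insert ha]; ring
    have h4 : ∑ x ∈ Ω, (∏ s ∈ insert a S, (f s x + f' s x) / 2) * R x
        = (∑ x ∈ Ω, (∏ s ∈ S, (f s x + f' s x) / 2) * (f a x * R x)
          + ∑ x ∈ Ω, (∏ s ∈ S, (f s x + f' s x) / 2) * (f' a x * R x)) / 2 := by
      rw [← Finset.sum_add_distrib, Finset.sum_div]
      exact Finset.sum_congr rfl fun x _ => by rw [Finset.prod_insert ha]; ring
    rw [h3, h4, h1, ← h2]
    ring

/-- Permutations act transitively on embeddings of `Fin k`, so averaging over the permutations of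
one embedding is averaging over all embeddings. -/
theorem expect_perm_eq_expect_embedding {α : Type*} [Fintype α] [DecidableEq α] {k : ℕ}
    (e : Fin k ↪ α) (Φ : (Fin k ↪ α) → ℝ) :
    Finset.expect Finset.univ (fun σ : Equiv.Perm α => Φ (e.trans σ.toEmbedding))
      = Finset.expect Finset.univ Φ := by
  have h1 : ∀ e' : Fin k ↪ α,
      Finset.expect Finset.univ (fun σ : Equiv.Perm α => Φ (e'.trans σ.toEmbedding))
      = Finset.expect Finset.univ (fun σ : Equiv.Perm α => Φ (e.trans σ.toEmbedding)) := by
    intro e'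
    obtain ⟨π, hπ⟩ := Equiv.Perm.exists_extending_pair e e' e.injective e'.injective
    refine Fintype.expect_equiv (Equiv.mulRight π) _ _ fun σ => ?_
    congr 1
    ext i
    simp [hπ]
  have h2 : ∀ σ : Equiv.Perm α,
      Finset.expect Finset.univ (fun e' : Fin k ↪ α => Φ (e'.trans σ.toEmbedding))
        = Finset.expect Finset.univ Φ := fun σ =>
    Fintype.expect_equiv (Equiv.embeddingCongr (Equiv.refl _) σ) _ _ fun e' => by
      congr 1
  have : Nonempty (Fin k ↪ α) := ⟨e⟩
  rw [← Finset.expect_const (Finset.univ_nonempty (α := Fin k ↪ α))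
    (Finset.expect Finset.univ (fun σ : Equiv.Perm α => Φ (e.trans σ.toEmbedding))),
    ← Finset.expect_const (Finset.univ_nonempty (α := Equiv.Perm α)) (Finset.expect Finset.univ Φ),
    ← Finset.expect_congr rfl (fun e' _ => h1 e'), ← Finset.expect_congr rfl (fun σ _ => h2 σ),
    Finset.expect_comm]

/-! ### Concentration for random disjoint pairs of indices -/

section PairStatistics

variable {α : Type*} [Fintype α]

/-- The mean of `D i k` over all ordered pairs of distinct indices. -/
noncomputable def pairMean (D : α → α → ℝ) : ℝ :=
  Finset.expect Finset.univ fun e : Fin 2 ↪ α => D (e 0) (e 1)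

theorem pairMean_nonneg {D : α → α → ℝ} (hD : ∀ i k, 0 ≤ D i k) : 0 ≤ pairMean D :=
  Finset.expect_nonneg fun _ _ => hD _ _

theorem pairMean_le_one {D : α → α → ℝ} (hD : ∀ i k, D i k ≤ 1) : pairMean D ≤ 1 := by
  rcases isEmpty_or_nonempty (Fin 2 ↪ α) with h | h
  · simp [pairMean]
  · exact Finset.expect_le Finset.univ_nonempty fun _ _ => hD _ _

variable [DecidableEq α]

theorem expect_perm_pair (D : α → α → ℝ) {a b : α} (hab : a ≠ b) :
    Finset.expect Finset.univ (fun σ : Equiv.Perm α => D (σ a) (σ b)) = pairMean D :=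
  expect_perm_eq_expect_embedding (Function.Embedding.embFinTwo hab) fun e => D (e 0) (e 1)

/-- Sampling four indices without replacement makes two disjoint pairs almost independent. -/
theorem expect_perm_two_pairs_le {D : α → α → ℝ} (hD : ∀ i k, 0 ≤ D i k)
    (hα : 7 ≤ Fintype.card α) {a b a' b' : α} (hab : a ≠ b) (haa : a ≠ a') (hab' : a ≠ b')
    (hba : b ≠ a') (hbb : b ≠ b') (hab'' : a' ≠ b') :
    Finset.expect Finset.univ
        (fun σ : Equiv.Perm α => D (σ a) (σ b) * D (σ a') (σ b'))
      ≤ (1 + 8 / Fintype.card α) * pairMean D ^ 2 := by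
  set v : Fin 4 → α := ![a, b, a', b'] with hv
  have hinj : Function.Injective v := by
    intro i j hij
    fin_cases i <;> fin_cases j <;> simp_all
  have h1 := expect_perm_eq_expect_embedding ⟨v, hinj⟩
    fun e => D (e 0) (e 1) * D (e 2) (e 3)
  have h2 : Finset.expect Finset.univ
        (fun σ : Equiv.Perm α => D (σ a) (σ b) * D (σ a') (σ b'))
      = Finset.expect Finset.univ fun e : Fin 4 ↪ α => D (e 0) (e 1) * D (e 2) (e 3) := by
    rw [← h1]; rfl
  rw [h2]
  have h3 : ∑ e : Fin 4 ↪ α, D (e 0) (e 1) * D (e 2) (e 3)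
      ≤ (∑ e : Fin 2 ↪ α, D (e 0) (e 1)) ^ 2 := by
    rw [sq, Finset.sum_mul_sum, ← Finset.sum_product']
    let φ : (Fin 4 ↪ α) → (Fin 2 ↪ α) × (Fin 2 ↪ α) := fun e =>
      (⟨![e 0, e 1], by intro i j; fin_cases i <;> fin_cases j <;> simp⟩,
        ⟨![e 2, e 3], by intro i j; fin_cases i <;> fin_cases j <;> simp⟩)
    have hφ : Function.Injective φ := by
      intro e e' h
      have h01 := congrArg (fun p => (p.1 0, p.1 1, p.2 0, p.2 1)) h
      simp [φ] at h01
      obtain ⟨h0, h1, h2, h3⟩ := h01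
      ext i
      fin_cases i
      exacts [h0, h1, h2, h3]
    calc ∑ e : Fin 4 ↪ α, D (e 0) (e 1) * D (e 2) (e 3)
        = ∑ p ∈ Finset.univ.image φ, D (p.1 0) (p.1 1) * D (p.2 0) (p.2 1) := by
          rw [Finset.sum_image fun _ _ _ _ h => hφ h]; rfl
      _ ≤ _ := Finset.sum_le_sum_of_subset_of_nonneg (by intro p _; simp)
          fun p _ _ => mul_nonneg (hD _ _) (hD _ _)
  have hd : (7 : ℝ) ≤ Fintype.card α := by exact_mod_cast hα
  rw [pairMean, Fintype.expect_eq_sum_div_card, Fintype.expect_eq_sum_div_card,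
    Fintype.card_embedding_eq, Fintype.card_embedding_eq]
  have hc4 : ((Nat.descFactorial (Fintype.card α) (Fintype.card (Fin 4)) : ℕ) : ℝ)
      = (Fintype.card α : ℝ) * (Fintype.card α - 1) * (Fintype.card α - 2)
        * (Fintype.card α - 3) := by
    obtain ⟨k, hk⟩ := Nat.exists_eq_add_of_le hα
    rw [hk]
    simp [Nat.descFactorial, show 7 + k - 3 = k + 4 by omega, show 7 + k - 2 = k + 5 by omega,
      show 7 + k - 1 = k + 6 by omega]
    ring
  have hc2 : ((Nat.descFactorial (Fintype.card α) (Fintype.card (Fin 2)) : ℕ) : ℝ)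
      = (Fintype.card α : ℝ) * (Fintype.card α - 1) := by
    obtain ⟨k, hk⟩ := Nat.exists_eq_add_of_le hα
    rw [hk]
    simp [Nat.descFactorial, show 7 + k - 1 = k + 6 by omega]
    ring
  rw [hc4, hc2]
  set d : ℝ := (Fintype.card α : ℝ)
  set S : ℝ := ∑ e : Fin 2 ↪ α, D (e 0) (e 1)
  refine (div_le_div_of_nonneg_right h3 (by
    have : 0 ≤ d - 1 := by linarith
    have : 0 ≤ d - 2 := by linarith
    have : 0 ≤ d - 3 := by linarith
    positivity)).trans ?_
  have e1 : (1 + 8 / d) * (S / (d * (d - 1))) ^ 2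
      = S ^ 2 * ((d + 8) / (d ^ 3 * (d - 1) ^ 2)) := by
    have : d - 1 ≠ 0 := by linarith
    have : d ≠ 0 := by linarith
    field_simp
  rw [e1, div_eq_mul_one_div]
  refine mul_le_mul_of_nonneg_left ?_ (sq_nonneg S)
  have p0 : 0 < d := by linarith
  have p1 : 0 < d - 1 := by linarith
  have p2 : 0 < d - 2 := by linarith
  have p3 : 0 < d - 3 := by linarith
  rw [div_le_div_iff₀ (by positivity) (by positivity)]
  have key : d ^ 2 * (d - 1) ≤ (d + 8) * ((d - 2) * (d - 3)) := by nlinarith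
  have := mul_le_mul_of_nonneg_left key (by positivity : 0 ≤ d * (d - 1))
  nlinarith

/-- A Chebyshev bound for `exp (-W)` in terms of the squared deviation of `W` from `m`. -/
theorem sq_mul_exp_neg_le {m W : ℝ} (hm : 0 ≤ m) (hW : 0 ≤ W) :
    m ^ 2 * Real.exp (-W) ≤ 2 * m + 4 * (W - m) ^ 2 := by
  rcases le_or_gt (m / 2) W with h | h
  · have h1 : Real.exp (-W) * (1 + W) ≤ 1 := by
      rw [Real.exp_neg, inv_mul_le_iff₀ (Real.exp_pos _)]
      linarith [Real.add_one_le_exp W]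
    have h2 : m * Real.exp (-W) ≤ 2 := by nlinarith [Real.exp_pos (-W)]
    nlinarith [sq_nonneg (W - m)]
  · have h1 : Real.exp (-W) ≤ 1 := Real.exp_le_one_iff.2 (by linarith)
    nlinarith [sq_nonneg m]

/-- Decay for a product over random disjoint pairs: the variance of the sum of the `D`'s is at most
a constant times its mean, whence Chebyshev's inequality applies. -/
theorem mul_expect_perm_prod_le {D : α → α → ℝ} (hD : ∀ i k, 0 ≤ D i k) (hD' : ∀ i k, D i k ≤ 1)
    (hα : 7 ≤ Fintype.card α) {r : ℕ} (a b : Fin r → α)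
    (hab : Function.Injective (Sum.elim a b)) :
    (r * pairMean D) * Finset.expect Finset.univ
      (fun σ : Equiv.Perm α => ∏ s, (1 - D (σ (a s)) (σ (b s)))) ≤ 38 := by
  have hne : ∀ s t, a s ≠ b t := fun s t h => by
    have := @hab (Sum.inl s) (Sum.inr t) h
    simp at this
  have ha : ∀ s t, s ≠ t → a s ≠ a t := fun s t hst h => hst (by
    simpa using @hab (Sum.inl s) (Sum.inl t) h)
  have hb : ∀ s t, s ≠ t → b s ≠ b t := fun s t hst h => hst (by
    simpa using @hab (Sum.inr s) (Sum.inr t) h)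
  have hrd : (r : ℝ) ≤ Fintype.card α := by
    have := Fintype.card_le_of_injective a fun s t h => by
      by_contra hst; exact ha s t hst h
    simpa using (by exact_mod_cast this : ((Fintype.card (Fin r) : ℕ) : ℝ) ≤ Fintype.card α)
  set δ := pairMean D with hδ
  have hδ0 : 0 ≤ δ := pairMean_nonneg hD
  have hδ1 : δ ≤ 1 := pairMean_le_one hD'
  set d : ℝ := (Fintype.card α : ℝ) with hd
  have hd7 : (7 : ℝ) ≤ d := by rw [hd]; exact_mod_cast hα
  set μ : ℝ := r * δ with hμ
  have hμ0 : 0 ≤ μ := by positivity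
  have hμd : μ ≤ d := by nlinarith [(Nat.cast_nonneg r : (0 : ℝ) ≤ r)]
  let W : Equiv.Perm α → ℝ := fun σ => ∑ s, D (σ (a s)) (σ (b s))
  have hW0 : ∀ σ, 0 ≤ W σ := fun σ => Finset.sum_nonneg fun s _ => hD _ _
  have hEW : Finset.expect Finset.univ W = μ := by
    rw [Finset.expect_sum_comm]
    simp_rw [expect_perm_pair D (hne _ _)]
    simp [hμ, hδ]
  have hEW2 : Finset.expect Finset.univ (fun σ => W σ ^ 2) ≤ μ + (1 + 8 / d) * μ ^ 2 := by
    have e1 : ∀ σ, W σ ^ 2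
        = ∑ s, ∑ t, D (σ (a s)) (σ (b s)) * D (σ (a t)) (σ (b t)) := fun σ => by
      rw [sq, Finset.sum_mul_sum]
    simp_rw [e1]
    rw [Finset.expect_sum_comm]
    simp_rw [Finset.expect_sum_comm]
    have e2 : ∀ s t, Finset.expect Finset.univ
        (fun σ : Equiv.Perm α => D (σ (a s)) (σ (b s)) * D (σ (a t)) (σ (b t)))
        ≤ (if s = t then δ else 0) + (1 + 8 / d) * δ ^ 2 := by
      intro s t
      have hnn : 0 ≤ (1 + 8 / d) * δ ^ 2 := by positivity
      by_cases hst : s = t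
      · subst hst
        rw [if_pos rfl]
        refine le_add_of_le_of_nonneg ?_ hnn
        rw [hδ, ← expect_perm_pair D (hne s s)]
        exact Finset.expect_le_expect fun σ _ => by
          nlinarith [hD (σ (a s)) (σ (b s)), hD' (σ (a s)) (σ (b s))]
      · rw [if_neg hst, zero_add]
        exact expect_perm_two_pairs_le hD hα (hne s s) (ha s t hst) (hne s t)
          (fun h => hne t s h.symm) (hb s t hst) (hne t t)
    refine (Finset.sum_le_sum fun s _ => Finset.sum_le_sum fun t _ => e2 s t).trans ?_
    simp [Finset.sum_add_distrib, hμ]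
    apply le_of_eq
    ring
  set E := Finset.expect Finset.univ
    (fun σ : Equiv.Perm α => ∏ s, (1 - D (σ (a s)) (σ (b s)))) with hE
  have hE0 : 0 ≤ E := Finset.expect_nonneg fun σ _ =>
    Finset.prod_nonneg fun s _ => by linarith [hD' (σ (a s)) (σ (b s))]
  have hEle : E ≤ Finset.expect Finset.univ (fun σ => Real.exp (-W σ)) := by
    refine Finset.expect_le_expect fun σ _ => ?_
    rw [← Finset.sum_neg_distrib, Real.exp_sum]
    exact Finset.prod_le_prod (fun s _ => by linarith [hD' (σ (a s)) (σ (b s))]) fun s _ => by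
      linarith [Real.add_one_le_exp (-D (σ (a s)) (σ (b s)))]
  -- The variance of `W` is at most `μ + 8 μ² / d`, and `μ ≤ d`.
  have hmain : μ ^ 2 * E ≤ 38 * μ := by
    calc μ ^ 2 * E ≤ μ ^ 2 * Finset.expect Finset.univ (fun σ => Real.exp (-W σ)) := by gcongr
      _ = Finset.expect Finset.univ (fun σ => μ ^ 2 * Real.exp (-W σ)) := Finset.mul_expect ..
      _ ≤ Finset.expect Finset.univ (fun σ => (4 * W σ ^ 2 + (-8 * μ) * W σ)
            + (2 * μ + 4 * μ ^ 2)) :=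
          Finset.expect_le_expect fun σ _ => by
            nlinarith [sq_mul_exp_neg_le hμ0 (hW0 σ)]
      _ = 4 * Finset.expect Finset.univ (fun σ => W σ ^ 2) - 8 * μ * μ
            + (2 * μ + 4 * μ ^ 2) := by
          rw [Finset.expect_add_distrib, Finset.expect_add_distrib,
            Finset.expect_const Finset.univ_nonempty,
            ← Finset.mul_expect, ← Finset.mul_expect, hEW]
          ring
      _ ≤ 4 * (μ + (1 + 8 / d) * μ ^ 2) - 8 * μ * μ + (2 * μ + 4 * μ ^ 2) := by gcongr
      _ = 6 * μ + 32 * (μ * (μ / d)) := by ring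
      _ ≤ 6 * μ + 32 * (μ * 1) := by
          gcongr
          exact (div_le_one (by linarith)).2 hμd
      _ = 38 * μ := by ring
  rcases hμ0.eq_or_lt with h | h
  · rw [← h]; norm_num
  · nlinarith

end PairStatistics

/-! ### Products of cosines averaged over permutations -/

section CosineProducts

variable {α : Type*} [Fintype α]

/-- The normalized energy `|α|⁻¹ ∑ᵢ sin² (θᵢ / 2) ∈ [0, 1]` of a frequency `θ`. It measures how far
`θ` is from `0`, and `1 - 2 * energy θ` is the symbol of the nearest neighbour random walk. -/
noncomputable def energy (θ : α → ℝ) : ℝ :=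
  (∑ i, Real.sin (θ i / 2) ^ 2) / Fintype.card α

theorem energy_nonneg (θ : α → ℝ) : 0 ≤ energy θ := by
  unfold energy; positivity

theorem energy_le_one (θ : α → ℝ) : energy θ ≤ 1 := by
  refine div_le_one_of_le₀ ?_ (by positivity)
  calc ∑ i, Real.sin (θ i / 2) ^ 2 ≤ ∑ _i : α, (1 : ℝ) :=
        Finset.sum_le_sum fun i _ => Real.sin_sq_le_one _
    _ = Fintype.card α := by simp

theorem cos_eq_one_sub_two_mul_sin_half_sq (t : ℝ) : Real.cos t = 1 - 2 * Real.sin (t / 2) ^ 2 := by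
  have := Real.cos_two_mul (t / 2)
  rw [show 2 * (t / 2) = t by ring] at this
  rw [this]
  linarith [Real.sin_sq_add_cos_sq (t / 2)]

/-- The loss `1 - |cos θᵢ + cos θₖ| / 2` incurred when a unit coordinate is shared between the
positions `i` and `k`. -/
noncomputable def pairLoss (θ : α → ℝ) (i k : α) : ℝ :=
  1 - |(Real.cos (θ i) + Real.cos (θ k)) / 2|

omit [Fintype α] in
theorem pairLoss_nonneg (θ : α → ℝ) (i k : α) : 0 ≤ pairLoss θ i k := by
  have h : |(Real.cos (θ i) + Real.cos (θ k)) / 2| ≤ 1 := by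
    rw [abs_le]
    constructor <;> linarith [Real.neg_one_le_cos (θ i), Real.neg_one_le_cos (θ k),
      Real.cos_le_one (θ i), Real.cos_le_one (θ k)]
  unfold pairLoss; linarith

omit [Fintype α] in
theorem pairLoss_le_one (θ : α → ℝ) (i k : α) : pairLoss θ i k ≤ 1 := by
  unfold pairLoss; linarith [abs_nonneg ((Real.cos (θ i) + Real.cos (θ k)) / 2)]

omit [Fintype α] in
theorem sin_sq_div_three_le_pairLoss (θ : α → ℝ) (i k : α)
    (hk : Real.sin (θ k / 2) ^ 2 ≤ 1 / 2) : Real.sin (θ i / 2) ^ 2 / 3 ≤ pairLoss θ i k := by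
  have h : |(Real.cos (θ i) + Real.cos (θ k)) / 2| ≤ 1 - Real.sin (θ i / 2) ^ 2 / 3 := by
    rw [cos_eq_one_sub_two_mul_sin_half_sq, cos_eq_one_sub_two_mul_sin_half_sq, abs_le]
    constructor <;> nlinarith [sq_nonneg (Real.sin (θ i / 2)), sq_nonneg (Real.sin (θ k / 2)),
      Real.sin_sq_le_one (θ i / 2)]
  unfold pairLoss; linarith

/-- If at least half of the cosines are nonnegative, the mean pair loss controls the energy. -/
theorem energy_le_pairMean (θ : α → ℝ) (hα : 5 ≤ Fintype.card α)
    (hθ : Fintype.card α ≤ 2 * (Finset.univ.filter fun i => Real.sin (θ i / 2) ^ 2 ≤ 1 / 2).card) :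
    energy θ / 8 ≤ pairMean (pairLoss θ) := by
  classical
  set L := Finset.univ.filter fun i => Real.sin (θ i / 2) ^ 2 ≤ 1 / 2 with hL
  set d : ℝ := (Fintype.card α : ℝ) with hd
  have hd5 : (5 : ℝ) ≤ d := by rw [hd]; exact_mod_cast hα
  have hLd : d / 2 ≤ L.card := by
    have : d ≤ 2 * (L.card : ℝ) := by rw [hd]; exact_mod_cast hθ
    linarith
  have hsum : ∑ e : Fin 2 ↪ α, pairLoss θ (e 0) (e 1)
      = ∑ i, ∑ k ∈ Finset.univ.erase i, pairLoss θ i k := by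
    rw [Finset.sum_sigma']
    refine Finset.sum_bij' (fun e _ => ⟨e 0, e 1⟩)
      (fun p hp => Function.Embedding.embFinTwo (a := p.1) (b := p.2)
        (by simp at hp; exact fun h => hp h.symm)) ?_ ?_ ?_ ?_ ?_
    · intro e _; simp
    · intro p _; simp
    · intro e _
      ext i
      fin_cases i
      · rfl
      · rfl
    · intro p _; rfl
    · intro e _; rfl
  have hlow : ∀ i, Real.sin (θ i / 2) ^ 2 * ((d / 2 - 1) / 3)
      ≤ ∑ k ∈ Finset.univ.erase i, pairLoss θ i k := by
    intro i
    calc Real.sin (θ i / 2) ^ 2 * ((d / 2 - 1) / 3)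
        = (d / 2 - 1) * (Real.sin (θ i / 2) ^ 2 / 3) := by ring
      _ ≤ ((L.erase i).card : ℝ) * (Real.sin (θ i / 2) ^ 2 / 3) := by
          have h1 : L.card ≤ (L.erase i).card + 1 := by
            have := Finset.pred_card_le_card_erase (s := L) (a := i)
            omega
          have h2 : (L.card : ℝ) ≤ (L.erase i).card + 1 := by exact_mod_cast h1
          gcongr
          linarith
      _ = ∑ _k ∈ L.erase i, Real.sin (θ i / 2) ^ 2 / 3 := by simp
      _ ≤ ∑ k ∈ L.erase i, pairLoss θ i k := Finset.sum_le_sum fun k hk =>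
          sin_sq_div_three_le_pairLoss θ i k
            (by simpa [hL] using Finset.mem_of_mem_erase hk)
      _ ≤ ∑ k ∈ Finset.univ.erase i, pairLoss θ i k :=
          Finset.sum_le_sum_of_subset_of_nonneg
            (Finset.erase_subset_erase _ (Finset.subset_univ _))
            fun k _ _ => pairLoss_nonneg θ i k
  have hc2 : ((Nat.descFactorial (Fintype.card α) (Fintype.card (Fin 2)) : ℕ) : ℝ)
      = d * (d - 1) := by
    obtain ⟨k, hk⟩ := Nat.exists_eq_add_of_le hα
    rw [hd, hk]
    simp [Nat.descFactorial, show 5 + k - 1 = k + 4 by omega]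
    ring
  rw [pairMean, Fintype.expect_eq_sum_div_card, Fintype.card_embedding_eq, hc2, hsum]
  set A := ∑ i, Real.sin (θ i / 2) ^ 2 with hA
  have hA0 : 0 ≤ A := Finset.sum_nonneg fun i _ => sq_nonneg _
  have h1 : A * ((d / 2 - 1) / 3) ≤ ∑ i, ∑ k ∈ Finset.univ.erase i, pairLoss θ i k := by
    rw [hA, Finset.sum_mul]
    exact Finset.sum_le_sum fun i _ => hlow i
  have h2 : energy θ = A / d := rfl
  rw [h2, le_div_iff₀ (by nlinarith)]
  refine le_trans ?_ h1
  have h3 : A / d / 8 * (d * (d - 1)) = A * ((d - 1) / 8) := by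
    have : d ≠ 0 := by linarith
    field_simp
  rw [h3]
  exact mul_le_mul_of_nonneg_left (by linarith) hA0

variable [DecidableEq α]

/-- Exchanging each unit coordinate `a s` with a vanishing coordinate `b s` replaces the factor
`cos θ` at `a s` by the mean of two cosines. -/
theorem abs_expect_perm_prod_cos_le (θ : α → ℝ) (x : α → ℤ) {r : ℕ} (a b : Fin r → α)
    (hab : Function.Injective (Sum.elim a b)) (hxa : ∀ s, |x (a s)| = 1)
    (hxb : ∀ s, x (b s) = 0) :
    |Finset.expect Finset.univ fun σ : Equiv.Perm α => ∏ j, Real.cos (x j * θ (σ j))|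
      ≤ Finset.expect Finset.univ fun σ : Equiv.Perm α =>
        ∏ s, (1 - pairLoss θ (σ (a s)) (σ (b s))) := by
  have hne : ∀ s t, a s ≠ b t := fun s t h => by
    have := @hab (Sum.inl s) (Sum.inr t) h
    simp at this
  have ha : Function.Injective a := fun s t h => by
    simpa using @hab (Sum.inl s) (Sum.inl t) h
  have hb : Function.Injective b := fun s t h => by
    simpa using @hab (Sum.inr s) (Sum.inr t) h
  let R : Equiv.Perm α → ℝ := fun σ =>
    ∏ j ∈ (Finset.univ.image a)ᶜ, Real.cos (x j * θ (σ j))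
  have hsplit : ∀ σ : Equiv.Perm α, ∏ j, Real.cos (x j * θ (σ j))
      = (∏ s, Real.cos (θ (σ (a s)))) * R σ := by
    intro σ
    rw [← Finset.prod_mul_prod_compl (Finset.univ.image a),
      Finset.prod_image fun s _ t _ h => ha h]
    congr 1
    refine Finset.prod_congr rfl fun s _ => ?_
    rcases (abs_eq zero_le_one).1 (hxa s) with h | h <;> simp [h]
  have hR : ∀ s (σ : Equiv.Perm α), R (σ * Equiv.swap (a s) (b s)) = R σ := by
    intro s σ
    refine Finset.prod_congr rfl fun j hj => ?_
    have hja : j ≠ a s := fun h => by simp [h] at hj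
    by_cases hjb : j = b s
    · simp [hjb, hxb]
    · simp [Equiv.swap_apply_of_ne_of_ne hja hjb]
  have hR1 : ∀ σ, |R σ| ≤ 1 := fun σ => by
    rw [Finset.abs_prod]
    exact Finset.prod_le_one (fun _ _ => abs_nonneg _) fun _ _ => Real.abs_cos_le_one _
  have key := sum_prod_eq_sum_prod_mean (Finset.univ : Finset (Equiv.Perm α))
    (fun s σ => σ * Equiv.swap (a s) (b s)) (fun s σ => Real.cos (θ (σ (a s))))
    (fun s σ => Real.cos (θ (σ (b s)))) (fun _ _ _ => Finset.mem_univ _)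
    (fun s σ => by simp [mul_assoc]) (fun s σ => by simp)
    (fun s t σ h => by
      simp [Equiv.swap_apply_of_ne_of_ne (ha.ne h.symm) (hne s t)])
    (fun s t σ h => by
      simp [Equiv.swap_apply_of_ne_of_ne (hne t s).symm (hb.ne h.symm)])
    Finset.univ R (fun s _ σ => hR s σ)
  have heq : (Finset.expect Finset.univ fun σ : Equiv.Perm α => ∏ j, Real.cos (x j * θ (σ j)))
      = Finset.expect Finset.univ fun σ : Equiv.Perm α =>
        (∏ s, (Real.cos (θ (σ (a s))) + Real.cos (θ (σ (b s)))) / 2) * R σ := by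
    rw [Finset.expect, Finset.expect, ← key]
    simp_rw [hsplit]
  rw [heq]
  refine (Finset.abs_expect_le _ _).trans (Finset.expect_le_expect fun σ _ => ?_)
  rw [abs_mul, Finset.abs_prod]
  refine (mul_le_of_le_one_right (Finset.prod_nonneg fun _ _ => abs_nonneg _) (hR1 σ)).trans
    (le_of_eq (Finset.prod_congr rfl fun s _ => ?_))
  simp [pairLoss]

/-- Permutation averages of `∏ cos (xⱼ θⱼ)` decay in the number of unit coordinates of `x`, provided
that `x` has at least as many vanishing coordinates and that half of the cosines of `θ` are
nonnegative. -/
theorem abs_expect_perm_prod_cos_mul_le (θ : α → ℝ) (x : α → ℤ) (hα : 7 ≤ Fintype.card α)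
    (hθ : Fintype.card α ≤ 2 * (Finset.univ.filter fun i => Real.sin (θ i / 2) ^ 2 ≤ 1 / 2).card)
    (hx : (Finset.univ.filter fun j => |x j| = 1).card
      ≤ (Finset.univ.filter fun j => x j = 0).card) :
    |Finset.expect Finset.univ fun σ : Equiv.Perm α => ∏ j, Real.cos (x j * θ (σ j))|
      * ((Finset.univ.filter fun j => |x j| = 1).card * energy θ) ≤ 304 := by
  set I := Finset.univ.filter fun j => |x j| = 1 with hI
  obtain ⟨J, hJ, hJI⟩ := Finset.exists_subset_card_eq hx
  let a : Fin I.card → α := fun s => I.equivFin.symm s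
  let b : Fin I.card → α := fun s => (J.equivFinOfCardEq hJI).symm s
  have hxa : ∀ s, |x (a s)| = 1 := fun s =>
    (Finset.mem_filter.1 (I.equivFin.symm s).2).2
  have hxb : ∀ s, x (b s) = 0 := fun s => by
    simpa using hJ ((J.equivFinOfCardEq hJI).symm s).2
  have hab : Function.Injective (Sum.elim a b) := by
    refine Function.Injective.sumElim
      (Subtype.val_injective.comp I.equivFin.symm.injective)
      (Subtype.val_injective.comp (J.equivFinOfCardEq hJI).symm.injective) fun s t h => ?_
    have h1 := hxa s
    rw [h, hxb t] at h1
    simp at h1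
  have h1 := abs_expect_perm_prod_cos_le θ x a b hab hxa hxb
  have h2 := mul_expect_perm_prod_le (pairLoss_nonneg θ) (pairLoss_le_one θ) hα a b hab
  have h3 := energy_le_pairMean θ (by omega) hθ
  set E := Finset.expect Finset.univ fun σ : Equiv.Perm α =>
        ∏ s, (1 - pairLoss θ (σ (a s)) (σ (b s))) with hE
  have hE0 : 0 ≤ E := (abs_nonneg _).trans h1
  have he := energy_nonneg θ
  calc _ ≤ E * (I.card * (8 * pairMean (pairLoss θ))) := by
        gcongr
        linarith
    _ = 8 * (I.card * pairMean (pairLoss θ) * E) := by ring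
    _ ≤ 8 * 38 := by gcongr
    _ = 304 := by norm_num

end CosineProducts

/-! ### Most lattice points of a small ball have many unit coordinates -/

theorem sum_Icc_neg_succ {M : Type*} [AddCommMonoid M] (g : ℤ → M) (m : ℕ) :
    ∑ k ∈ Finset.Icc (-((m + 1 : ℕ) : ℤ)) ((m + 1 : ℕ) : ℤ), g k
      = g ((m + 1 : ℕ) : ℤ) + (g (-((m + 1 : ℕ) : ℤ)) + ∑ k ∈ Finset.Icc (-(m : ℤ)) m, g k) := by
  have h : Finset.Icc (-((m + 1 : ℕ) : ℤ)) ((m + 1 : ℕ) : ℤ)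
      = insert ((m + 1 : ℕ) : ℤ) (insert (-((m + 1 : ℕ) : ℤ)) (Finset.Icc (-(m : ℤ)) m)) := by
    ext k
    simp only [Finset.mem_insert, Finset.mem_Icc]
    omega
  rw [h, Finset.sum_insert, Finset.sum_insert]
  · simp
  · simp only [Finset.mem_insert, Finset.mem_Icc]
    omega

/-- The weight `s ^ k²` of an integer `k`, damped by `1 / 256` at `k = ±1`. -/
noncomputable def dampedWeight (s : ℝ) (k : ℤ) : ℝ :=
  s ^ (k.natAbs ^ 2) * if |k| = 1 then 1 / 256 else 1

theorem dampedWeight_nonneg {s : ℝ} (hs : 0 ≤ s) (k : ℤ) : 0 ≤ dampedWeight s k := by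
  unfold dampedWeight; split_ifs <;> positivity

theorem sum_dampedWeight_le {s : ℝ} (hs : 0 ≤ s) (hs' : s ≤ 1 / 16) {m : ℕ} (hm : 1 ≤ m) :
    ∑ k ∈ Finset.Icc (-(m : ℤ)) m, dampedWeight s k
      ≤ 1 + s / 128 + 3 * s ^ 4 := by
  -- The subtracted term pays for the two new weights `s ^ (m + 1)² ≤ s ^ (m + 3)` in each step.
  suffices h : ∑ k ∈ Finset.Icc (-(m : ℤ)) m, dampedWeight s k
      ≤ 1 + s / 128 + 3 * s ^ 4 - 3 * s ^ (m + 3) by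
    have : 0 ≤ s ^ (m + 3) := by positivity
    linarith
  induction m, hm using Nat.le_induction with
  | base =>
    rw [sum_Icc_neg_succ]
    simp [dampedWeight]
    linarith
  | succ m hm ih =>
    rw [sum_Icc_neg_succ]
    have h1 : ∀ k : ℤ, k.natAbs = m + 1 → dampedWeight s k ≤ s ^ (m + 3) := by
      intro k hk
      have hk1 : ¬ |k| = 1 := by rw [Int.abs_eq_natAbs]; omega
      rw [dampedWeight, if_neg hk1, mul_one, hk]
      exact pow_le_pow_of_le_one hs (by linarith) (by nlinarith)
    have h2 := h1 ((m + 1 : ℕ) : ℤ) (by omega)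
    have h3 := h1 (-((m + 1 : ℕ) : ℤ)) (by omega)
    have h4 : s ^ (m + 1 + 3) = s * s ^ (m + 3) := by ring
    have h5 : 0 ≤ s ^ (m + 3) := by positivity
    rw [h4]
    nlinarith

theorem choose_le_card_ball {d n : ℕ} (B : Finset (Fin d → ℤ))
    (hB : ∀ x, x ∈ B ↔ ∑ i, x i ^ 2 ≤ (n : ℤ)) : d.choose n ≤ B.card := by
  have h := Finset.card_powersetCard n (Finset.univ : Finset (Fin d))
  rw [Finset.card_univ, Fintype.card_fin] at h
  rw [← h]
  refine Finset.card_le_card_of_injOn (fun I i => if i ∈ I then 1 else 0) ?_ ?_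
  · intro I hI
    have hI' := (Finset.mem_powersetCard.1 hI).2
    rw [Finset.mem_coe, hB]
    simp [hI']
  · intro I _ J _ h
    ext i
    have := congrFun h i
    by_cases h1 : i ∈ I <;> by_cases h2 : i ∈ J <;> simp_all

/-- A Chernoff bound: if `n` is small compared to `d`, all but a fraction `2 ^ (-n)` of the lattice
points with `|x|² ≤ n` have at least `n / 4` coordinates `±1`. -/
theorem card_few_units_mul_le {d n : ℕ} (hn : 1 ≤ n) (hd : 512 * n ≤ d) (B : Finset (Fin d → ℤ))
    (hB : ∀ x, x ∈ B ↔ ∑ i, x i ^ 2 ≤ (n : ℤ)) :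
    ((B.filter fun x => 4 * (Finset.univ.filter fun i => |x i| = 1).card < n).card : ℝ) * 2 ^ n
      ≤ B.card := by
  set Bad := B.filter fun x => 4 * (Finset.univ.filter fun i => |x i| = 1).card < n with hBad
  have hnR : (1 : ℝ) ≤ n := by exact_mod_cast hn
  have hdR : 512 * (n : ℝ) ≤ d := by exact_mod_cast hd
  have hd0 : (0 : ℝ) < d := by linarith
  -- The generating function is evaluated at a point of the order of its saddle point `n / d`; with
  -- the factor `32` it beats both the damping and the lower bound `(d / (2 n)) ^ n` for the ball.
  set s : ℝ := 32 * n / d with hs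
  have hs0 : 0 < s := by positivity
  have hs1 : s ≤ 1 / 16 := by
    rw [hs, div_le_iff₀ hd0]; linarith
  -- The damping `1 / 256 = (1 / 4) ^ 4` penalizes each unit coordinate of a bad point, of which
  -- there are fewer than `n / 4`.
  have hpt : ∀ x ∈ Bad, s ^ n * (1 / 4) ^ n ≤ ∏ i, dampedWeight s (x i) := by
    intro x hx
    obtain ⟨hxB, hxr⟩ := Finset.mem_filter.1 hx
    have h1 : ∑ i, (x i).natAbs ^ 2 ≤ n := by
      have := (hB x).1 hxB
      zify
      simpa using this
    simp only [dampedWeight]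
    rw [Finset.prod_mul_distrib, Finset.prod_pow_eq_pow_sum, Finset.prod_ite]
    simp only [Finset.prod_const, one_pow, mul_one]
    refine mul_le_mul (pow_le_pow_of_le_one hs0.le (by linarith) h1) ?_ (by positivity)
      (by positivity)
    rw [show (1 / 256 : ℝ) = (1 / 4) ^ 4 by norm_num, ← pow_mul]
    exact pow_le_pow_of_le_one (by norm_num) (by norm_num) hxr.le
  have hsub : Bad ⊆ Fintype.piFinset fun _ : Fin d => Finset.Icc (-(n : ℤ)) n := by
    intro x hx
    have hxB := (hB x).1 (Finset.mem_filter.1 hx).1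
    rw [Fintype.mem_piFinset]
    intro i
    have h1 : x i ^ 2 ≤ n :=
      (Finset.single_le_sum (f := fun i => x i ^ 2) (fun i _ => sq_nonneg _)
        (Finset.mem_univ i)).trans hxB
    rw [Finset.mem_Icc]
    constructor <;> nlinarith
  have hcount : (Bad.card : ℝ) * (s ^ n * (1 / 4) ^ n) ≤ 2 ^ n := by
    calc (Bad.card : ℝ) * (s ^ n * (1 / 4) ^ n)
        = ∑ _x ∈ Bad, s ^ n * (1 / 4) ^ n := by simp
      _ ≤ ∑ x ∈ Bad, ∏ i, dampedWeight s (x i) := Finset.sum_le_sum hpt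
      _ ≤ ∑ x ∈ Fintype.piFinset fun _ : Fin d => Finset.Icc (-(n : ℤ)) n,
            ∏ i, dampedWeight s (x i) :=
          Finset.sum_le_sum_of_subset_of_nonneg hsub fun x _ _ =>
            Finset.prod_nonneg fun i _ => dampedWeight_nonneg hs0.le _
      _ = (∑ k ∈ Finset.Icc (-(n : ℤ)) n, dampedWeight s k) ^ d := by
          rw [← Finset.prod_univ_sum]; simp
      _ ≤ (1 + (s / 128 + 3 * s ^ 4)) ^ d := by
          refine pow_le_pow_left₀ (Finset.sum_nonneg fun k _ => dampedWeight_nonneg hs0.le _) ?_ d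
          rw [← add_assoc]
          exact sum_dampedWeight_le hs0.le hs1 hn
      _ ≤ (Real.exp (s / 128 + 3 * s ^ 4)) ^ d :=
          pow_le_pow_left₀ (by positivity) (by
            rw [add_comm]; exact Real.add_one_le_exp _) d
      _ = Real.exp (d * s / 128 + 3 * (d * s) * s ^ 3) := by
          rw [← Real.exp_nat_mul]; ring_nf
      _ ≤ Real.exp (n * (1 / 2)) := by
          have h1 : d * s = 32 * n := by rw [hs]; field_simp
          have h2 : s ^ 3 ≤ (1 / 16) ^ 3 := pow_le_pow_left₀ hs0.le hs1 3
          rw [h1]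
          apply Real.exp_le_exp.2
          nlinarith
      _ = (Real.exp (1 / 2)) ^ n := Real.exp_nat_mul _ _
      _ ≤ 2 ^ n := by
          refine pow_le_pow_left₀ (Real.exp_pos _).le ?_ n
          have h1 : Real.exp (1 / 2) ^ 2 < 2 ^ 2 := by
            rw [← Real.exp_nat_mul]
            have := Real.exp_one_lt_d9
            norm_num
            linarith
          exact (lt_of_pow_lt_pow_left₀ 2 (by norm_num) h1).le
  have hball : ((d : ℝ) / (2 * n)) ^ n ≤ B.card := by
    have h1 := Nat.pow_le_choose (α := ℝ) n d
    have h2 : (d.choose n : ℝ) ≤ B.card := by exact_mod_cast choose_le_card_ball B hB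
    refine le_trans ?_ (h1.trans h2)
    have h3 : (n.factorial : ℝ) ≤ (n : ℝ) ^ n := by exact_mod_cast Nat.factorial_le_pow n
    have h4 : (d : ℝ) / 2 ≤ ((d + 1 - n : ℕ) : ℝ) := by
      rw [Nat.cast_sub (by omega)]
      push_cast
      linarith
    calc ((d : ℝ) / (2 * n)) ^ n = (d / 2) ^ n / n ^ n := by
          rw [← div_pow, div_div]
      _ ≤ ((d + 1 - n : ℕ) : ℝ) ^ n / n.factorial := by
          gcongr
      _ = (((d + 1 - n : ℕ) ^ n : ℕ) : ℝ) / n.factorial := by push_cast; rfl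
      _ ≤ _ := by norm_num
  refine le_trans ?_ hball
  have h1 : (d / (2 * n) : ℝ) ^ n * (s ^ n * (1 / 4) ^ n) = 2 ^ n * 2 ^ n := by
    rw [← mul_pow, ← mul_pow, ← mul_pow]
    congr 1
    rw [hs]
    field_simp
    norm_num
  refine le_of_mul_le_mul_right ?_ (by positivity : 0 < s ^ n * (1 / 4) ^ n)
  rw [h1]
  calc (Bad.card : ℝ) * 2 ^ n * (s ^ n * (1 / 4) ^ n)
      = Bad.card * (s ^ n * (1 / 4) ^ n) * 2 ^ n := by ring
    _ ≤ 2 ^ n * 2 ^ n := by gcongr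

/-! ### The multiplier of a ball average near and away from its peaks -/

theorem abs_sin_nat_mul_le (k : ℕ) (t : ℝ) : |Real.sin (k * t)| ≤ k * |Real.sin t| := by
  induction k with
  | zero => simp
  | succ k ih =>
    have h : ((k + 1 : ℕ) : ℝ) * t = k * t + t := by push_cast; ring
    rw [h, Real.sin_add]
    have h1 : |Real.sin (k * t) * Real.cos t| ≤ |Real.sin (k * t)| := by
      rw [abs_mul]
      exact mul_le_of_le_one_right (abs_nonneg _) (Real.abs_cos_le_one _)
    have h2 : |Real.cos (k * t) * Real.sin t| ≤ |Real.sin t| := by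
      rw [abs_mul]
      exact mul_le_of_le_one_left (abs_nonneg _) (Real.abs_cos_le_one _)
    push_cast
    linarith [abs_add_le (Real.sin (k * t) * Real.cos t) (Real.cos (k * t) * Real.sin t)]

theorem one_sub_cos_int_mul_le (k : ℤ) (t : ℝ) :
    1 - Real.cos (k * t) ≤ 2 * ((k : ℝ) ^ 2 * Real.sin (t / 2) ^ 2) := by
  have h : Real.cos (k * t) = Real.cos (k.natAbs * t) := by
    rcases Int.natAbs_eq k with h | h
    · rw [show (k : ℝ) = ((k.natAbs : ℤ) : ℝ) by rw [← h]]; simp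
    · rw [show (k : ℝ) = ((-(k.natAbs : ℤ) : ℤ) : ℝ) by rw [← h], ← Real.cos_neg]; simp
  have hk : (k : ℝ) ^ 2 = (k.natAbs : ℝ) ^ 2 := by
    rw [Nat.cast_natAbs, Int.cast_abs, sq_abs]
  rw [h, hk, cos_eq_one_sub_two_mul_sin_half_sq, show (k.natAbs : ℝ) * t / 2 = k.natAbs * (t / 2) by
    ring, ← mul_pow]
  have := pow_le_pow_left₀ (abs_nonneg _) (abs_sin_nat_mul_le k.natAbs (t / 2)) 2
  rw [sq_abs, mul_pow, sq_abs, ← mul_pow] at this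
  linarith

theorem abs_one_sub_prod_le {ι : Type*} (s : Finset ι) (c : ι → ℝ) (hc : ∀ i, |c i| ≤ 1) :
    |1 - ∏ i ∈ s, c i| ≤ ∑ i ∈ s, (1 - c i) := by
  classical
  induction s using Finset.induction_on with
  | empty => simp
  | insert a s ha ih =>
    rw [Finset.prod_insert ha, Finset.sum_insert ha]
    have h1 : |∏ i ∈ s, c i| ≤ 1 := by
      rw [Finset.abs_prod]
      exact Finset.prod_le_one (fun _ _ => abs_nonneg _) fun i _ => hc i
    have h2 : 1 - c a * ∏ i ∈ s, c i = (1 - c a) * ∏ i ∈ s, c i + (1 - ∏ i ∈ s, c i) := by ring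
    rw [h2]
    refine (abs_add_le _ _).trans (add_le_add ?_ ih)
    have h3 : 0 ≤ 1 - c a := by linarith [(abs_le.1 (hc a)).2]
    rw [abs_mul, abs_of_nonneg h3]
    exact mul_le_of_le_one_right h3 h1

section Ball

variable {d n : ℕ} {B : Finset (Fin d → ℤ)}

theorem comp_perm_mem_ball (hB : ∀ x, x ∈ B ↔ ∑ i, x i ^ 2 ≤ (n : ℤ)) (σ : Equiv.Perm (Fin d))
    {x : Fin d → ℤ} (hx : x ∈ B) : x ∘ σ ∈ B := by
  rw [hB] at hx ⊢
  exact (Equiv.sum_comp σ fun i => x i ^ 2).trans_le hx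

theorem expect_ball_comp_perm (hB : ∀ x, x ∈ B ↔ ∑ i, x i ^ 2 ≤ (n : ℤ))
    (σ : Equiv.Perm (Fin d)) (F : (Fin d → ℤ) → ℝ) :
    Finset.expect B (fun x => F (x ∘ σ)) = Finset.expect B F :=
  Finset.expect_nbij' (fun x => x ∘ σ) (fun x => x ∘ ⇑σ⁻¹)
    (fun _ hx => comp_perm_mem_ball hB σ hx) (fun _ hx => comp_perm_mem_ball hB σ⁻¹ hx)
    (fun x _ => by ext i; simp) (fun x _ => by ext i; simp) fun x _ => rfl

/-- The mean over the lattice points `x` of a ball of `∏ cos (xⱼ θⱼ)`, weighted by `w x`. For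
`w = 1` it is the Fourier multiplier of the ball average. -/
noncomputable def cosMean (B : Finset (Fin d → ℤ)) (w : (Fin d → ℤ) → ℝ) (θ : Fin d → ℝ) : ℝ :=
  Finset.expect B fun x => w x * ∏ j, Real.cos (x j * θ j)

theorem abs_cosMean_le_one (w : (Fin d → ℤ) → ℝ) (hw : ∀ x, |w x| ≤ 1) (θ : Fin d → ℝ) :
    |cosMean B w θ| ≤ 1 := by
  rcases B.eq_empty_or_nonempty with h | h
  · simp [cosMean, h]
  · refine (Finset.abs_expect_le _ _).trans (Finset.expect_le h fun x _ => ?_)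
    rw [abs_mul, Finset.abs_prod]
    exact mul_le_one₀ (hw x) (Finset.prod_nonneg fun _ _ => abs_nonneg _)
      (Finset.prod_le_one (fun _ _ => abs_nonneg _) fun _ _ => Real.abs_cos_le_one _)

theorem expect_ball_sq_le (hB : ∀ x, x ∈ B ↔ ∑ i, x i ^ 2 ≤ (n : ℤ)) (hne : B.Nonempty)
    (j : Fin d) : Finset.expect B (fun x => (x j : ℝ) ^ 2) ≤ n / d := by
  have hd : (0 : ℝ) < d := by exact_mod_cast j.pos
  rw [le_div_iff₀ hd]
  have h1 : ∀ k, Finset.expect B (fun x => (x k : ℝ) ^ 2)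
      = Finset.expect B fun x => (x j : ℝ) ^ 2 := fun k => by
    rw [← expect_ball_comp_perm hB (Equiv.swap j k) fun x => (x j : ℝ) ^ 2]
    simp
  calc Finset.expect B (fun x => (x j : ℝ) ^ 2) * d
      = ∑ k, Finset.expect B fun x => (x k : ℝ) ^ 2 := by
        simp_rw [h1]; simp [mul_comm]
    _ = Finset.expect B fun x => ∑ k, (x k : ℝ) ^ 2 := by rw [Finset.expect_sum_comm]
    _ ≤ n := Finset.expect_le hne fun x hx => by exact_mod_cast (hB x).1 hx

/-- Near its peak at `0` the weighted multiplier is close to the mean of the weight. The bound is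
linear in `n * energy θ` because the mean of `xⱼ²` over the ball is at most `n / d` for each `j`. -/
theorem abs_cosMean_sub_le (hB : ∀ x, x ∈ B ↔ ∑ i, x i ^ 2 ≤ (n : ℤ)) (hne : B.Nonempty)
    (w : (Fin d → ℤ) → ℝ) (hw : ∀ x, |w x| ≤ 1) (θ : Fin d → ℝ) :
    |cosMean B w θ - Finset.expect B w| ≤ 2 * (n * energy θ) := by
  rw [cosMean, ← Finset.expect_sub_distrib]
  calc |Finset.expect B fun x => w x * ∏ j, Real.cos (x j * θ j) - w x|
      ≤ Finset.expect B fun x => |w x * ∏ j, Real.cos (x j * θ j) - w x| :=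
        Finset.abs_expect_le _ _
    _ ≤ Finset.expect B fun x => ∑ j, 2 * Real.sin (θ j / 2) ^ 2 * (x j : ℝ) ^ 2 := by
        refine Finset.expect_le_expect fun x _ => ?_
        rw [show w x * ∏ j, Real.cos (x j * θ j) - w x
          = -(w x * (1 - ∏ j, Real.cos (x j * θ j))) by ring, abs_neg, abs_mul]
        refine (mul_le_of_le_one_left (abs_nonneg _) (hw x)).trans
          ((abs_one_sub_prod_le _ _ fun j => Real.abs_cos_le_one _).trans
            (Finset.sum_le_sum fun j _ => (one_sub_cos_int_mul_le _ _).trans_eq (by ring)))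
    _ = ∑ j, 2 * Real.sin (θ j / 2) ^ 2 * Finset.expect B fun x => (x j : ℝ) ^ 2 := by
        rw [Finset.expect_sum_comm]
        simp_rw [Finset.mul_expect]
    _ ≤ ∑ j, 2 * Real.sin (θ j / 2) ^ 2 * (n / d) := by
        gcongr with j
        exact expect_ball_sq_le hB hne j
    _ = 2 * (n * energy θ) := by
        rw [← Finset.sum_mul, ← Finset.mul_sum, energy, Fintype.card_fin]; ring

theorem cosMean_eq_expect_perm (hB : ∀ x, x ∈ B ↔ ∑ i, x i ^ 2 ≤ (n : ℤ))
    (w : (Fin d → ℤ) → ℝ) (hw : ∀ (σ : Equiv.Perm (Fin d)) x, w (x ∘ σ) = w x)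
    (θ : Fin d → ℝ) :
    cosMean B w θ = Finset.expect B fun x => w x *
      Finset.expect Finset.univ fun σ : Equiv.Perm (Fin d) => ∏ j, Real.cos (x j * θ (σ j)) := by
  simp_rw [Finset.mul_expect]
  rw [Finset.expect_comm]
  have h : ∀ σ : Equiv.Perm (Fin d),
      Finset.expect B (fun x => w x * ∏ j, Real.cos (x j * θ (σ j))) = cosMean B w θ := by
    intro σ
    rw [cosMean, ← expect_ball_comp_perm hB σ]
    refine Finset.expect_congr rfl fun x _ => ?_
    rw [hw]
    exact congrArg (w x * ·) (Equiv.prod_comp σ fun j => Real.cos (x j * θ j))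
  simp_rw [h]
  simp

/-- Away from its peaks the multiplier of a ball average decays: most points of the ball have many
unit coordinates, and for these the average over permutations decays. -/
theorem abs_cosMean_mul_le (hB : ∀ x, x ∈ B ↔ ∑ i, x i ^ 2 ≤ (n : ℤ)) (hn : 1 ≤ n)
    (hd : 512 * n ≤ d) (w : (Fin d → ℤ) → ℝ) (hw1 : ∀ x, |w x| ≤ 1)
    (hw : ∀ (σ : Equiv.Perm (Fin d)) x, w (x ∘ σ) = w x) (θ : Fin d → ℝ)
    (hθ : d ≤ 2 * (Finset.univ.filter fun i => Real.sin (θ i / 2) ^ 2 ≤ 1 / 2).card) :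
    |cosMean B w θ| * (n * energy θ) ≤ 1217 := by
  have hu0 := energy_nonneg θ
  have hu1 := energy_le_one θ
  have hne : B.Nonempty := ⟨0, by rw [hB]; simp⟩
  have hBpos : (0 : ℝ) < B.card := by exact_mod_cast hne.card_pos
  set P : (Fin d → ℤ) → ℝ := fun x => Finset.expect Finset.univ
    fun σ : Equiv.Perm (Fin d) => ∏ j, Real.cos (x j * θ (σ j)) with hP
  have hP1 : ∀ x, |P x| ≤ 1 := fun x =>
    (Finset.abs_expect_le _ _).trans (Finset.expect_le Finset.univ_nonempty fun σ _ => by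
      rw [Finset.abs_prod]
      exact Finset.prod_le_one (fun _ _ => abs_nonneg _) fun _ _ => Real.abs_cos_le_one _)
  have hpt : ∀ x ∈ B, |P x| * (n * energy θ) ≤ 1216
      + if 4 * (Finset.univ.filter fun i => |x i| = 1).card < n then (n : ℝ) else 0 := by
    intro x hx
    split_ifs with h
    · have : |P x| * (n * energy θ) ≤ 1 * (n * 1) := by gcongr; exact hP1 x
      linarith
    · have h0 : (Finset.univ.filter fun j => |x j| = 1).card
          ≤ (Finset.univ.filter fun j => x j = 0).card := by
        have hx' := (hB x).1 hx
        have h1 : ((Finset.univ.filter fun j => ¬ x j = 0).card : ℤ) ≤ n := by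
          refine le_trans ?_ hx'
          rw [Finset.card_filter]
          push_cast
          refine Finset.sum_le_sum fun j _ => ?_
          split_ifs with hj
          · exact sq_nonneg _
          · rw [← sq_abs]
            nlinarith [Int.one_le_abs hj]
        have h2 : (Finset.univ.filter fun j => |x j| = 1).card
            ≤ (Finset.univ.filter fun j => ¬ x j = 0).card :=
          Finset.card_le_card fun j hj => by
            simp only [Finset.mem_filter, Finset.mem_univ, true_and] at hj ⊢
            intro h; simp [h] at hj
        have h3 := Finset.card_filter_add_card_filter_not (s := (Finset.univ : Finset (Fin d)))
          (fun j => x j = 0)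
        rw [Finset.card_univ, Fintype.card_fin] at h3
        omega
      have h1 := abs_expect_perm_prod_cos_mul_le θ x (by simp; omega) (by simpa using hθ) h0
      have h2 : (n : ℝ) ≤ 4 * (Finset.univ.filter fun i => |x i| = 1).card := by
        exact_mod_cast not_lt.1 h
      calc |P x| * (n * energy θ)
          ≤ |P x| * (4 * (Finset.univ.filter fun i => |x i| = 1).card * energy θ) := by gcongr
        _ = 4 * (|P x| * ((Finset.univ.filter fun i => |x i| = 1).card * energy θ)) := by ring
        _ ≤ 4 * 304 := by gcongr
        _ = 1216 + 0 := by norm_num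
  calc |cosMean B w θ| * (n * energy θ)
      ≤ (Finset.expect B fun x => |P x|) * (n * energy θ) := by
        gcongr
        rw [cosMean_eq_expect_perm hB w hw]
        refine (Finset.abs_expect_le _ _).trans (Finset.expect_le_expect fun x _ => ?_)
        rw [abs_mul]
        exact mul_le_of_le_one_left (abs_nonneg _) (hw1 x)
    _ = Finset.expect B fun x => |P x| * (n * energy θ) := Finset.expect_mul ..
    _ ≤ Finset.expect B fun x => 1216
          + if 4 * (Finset.univ.filter fun i => |x i| = 1).card < n then (n : ℝ) else 0 :=
        Finset.expect_le_expect hpt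
    _ = 1216 + n * ((B.filter fun x =>
          4 * (Finset.univ.filter fun i => |x i| = 1).card < n).card / B.card) := by
        rw [Finset.expect_add_distrib, Finset.expect_const hne, Finset.expect_eq_sum_div_card,
          ← Finset.sum_filter]
        simp
        ring
    _ ≤ 1216 + n * (1 / 2 ^ n) := by
        refine add_le_add le_rfl (mul_le_mul_of_nonneg_left ?_ (Nat.cast_nonneg n))
        rw [div_le_div_iff₀ hBpos (by positivity), one_mul]
        exact card_few_units_mul_le hn hd B hB
    _ ≤ 1216 + 1 := by
        gcongr
        rw [mul_one_div, div_le_one (by positivity)]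
        exact_mod_cast Nat.lt_two_pow_self.le
    _ = 1217 := by norm_num

end Ball

/-! ### Comparison with the ergodic means of the nearest neighbour walk -/

/-- The mean `n⁻¹ ∑_{k < n} qᵏ`: the symbol of the ergodic mean of an operator with symbol `q`. -/
noncomputable def cesaro (n : ℕ) (q : ℝ) : ℝ := (n : ℝ)⁻¹ * ∑ k ∈ Finset.range n, q ^ k

theorem abs_one_sub_cesaro_le {n : ℕ} (hn : 1 ≤ n) {u : ℝ} (hu : 0 ≤ u) (hu1 : u ≤ 1) :
    |1 - cesaro n (1 - 2 * u)| ≤ 2 * (n * u) := by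
  have hn0 : (0 : ℝ) < n := by exact_mod_cast hn
  have h1 : 1 - cesaro n (1 - 2 * u)
      = (n : ℝ)⁻¹ * ∑ k ∈ Finset.range n, (1 - (1 - 2 * u) ^ k) := by
    rw [cesaro, Finset.sum_sub_distrib, mul_sub]
    simp [hn0.ne']
  rw [h1, abs_mul, abs_of_pos (inv_pos.2 hn0), inv_mul_le_iff₀ hn0]
  calc |∑ k ∈ Finset.range n, (1 - (1 - 2 * u) ^ k)|
      ≤ ∑ k ∈ Finset.range n, |1 - (1 - 2 * u) ^ k| := Finset.abs_sum_le_sum_abs _ _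
    _ ≤ ∑ _k ∈ Finset.range n, 2 * (n * u) := by
        refine Finset.sum_le_sum fun k hk => ?_
        have hk' : (k : ℝ) ≤ n := by exact_mod_cast (Finset.mem_range.1 hk).le
        have h2 : (1 - 2 * u) ^ k ≤ 1 := (le_abs_self _).trans (by
          rw [abs_pow]
          exact pow_le_one₀ (abs_nonneg _) (abs_le.2 ⟨by linarith, by linarith⟩))
        have h3 := one_add_mul_sub_le_pow (a := 1 - 2 * u) (by linarith) k
        rw [abs_of_nonneg (by linarith)]
        nlinarith
    _ = n * (2 * (n * u)) := by simp

theorem abs_cesaro_mul_le {n : ℕ} (hn : 1 ≤ n) {u : ℝ} (hu : 0 ≤ u) (hu1 : u ≤ 1) :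
    |cesaro n (1 - 2 * u)| * (n * u) ≤ 1 := by
  have hn0 : (0 : ℝ) < n := by exact_mod_cast hn
  have h1 := mul_neg_geom_sum (1 - 2 * u) n
  have h2 : |(1 - 2 * u) ^ n| ≤ 1 := by
    rw [abs_pow]
    exact pow_le_one₀ (abs_nonneg _) (abs_le.2 ⟨by linarith, by linarith⟩)
  have h3 : cesaro n (1 - 2 * u) * (n * u) = (1 - (1 - 2 * u) ^ n) / 2 := by
    rw [← h1, cesaro]
    field_simp
    ring
  rw [← abs_of_nonneg (by positivity : 0 ≤ n * u), ← abs_mul, h3, abs_le]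
  rw [abs_le] at h2
  constructor <;> linarith [h2.1, h2.2]

theorem le_mul_div_of_le_of_mul_le {e t C : ℝ} (ht : 0 ≤ t) (h1 : e ≤ 4 * t) (h2 : e * t ≤ C) :
    e ≤ (C + 4) * (t / (1 + t ^ 2)) := by
  rw [← mul_div_assoc, le_div_iff₀ (by positivity)]
  nlinarith

section Ball

variable {d n : ℕ} {B : Finset (Fin d → ℤ)}

theorem energy_add_pi [NeZero d] (θ : Fin d → ℝ) :
    energy (fun i => θ i + Real.pi) = 1 - energy θ := by
  have hd : (d : ℝ) ≠ 0 := by exact_mod_cast NeZero.ne d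
  have h : ∀ i, Real.sin ((θ i + Real.pi) / 2) ^ 2 = 1 - Real.sin (θ i / 2) ^ 2 := fun i => by
    rw [show (θ i + Real.pi) / 2 = θ i / 2 + Real.pi / 2 by ring, Real.sin_add_pi_div_two]
    linarith [Real.sin_sq_add_cos_sq (θ i / 2)]
  simp only [energy, h, Finset.sum_sub_distrib]
  simp [sub_div, hd]

theorem energy_le_of_half_small [NeZero d] (θ : Fin d → ℝ)
    (hθ : d ≤ 2 * (Finset.univ.filter fun i => Real.sin (θ i / 2) ^ 2 ≤ 1 / 2).card) :
    energy θ ≤ 3 / 4 := by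
  have hd : (0 : ℝ) < d := by exact_mod_cast NeZero.pos d
  have hθ' : (d : ℝ) ≤ 2 * (Finset.univ.filter fun i => Real.sin (θ i / 2) ^ 2 ≤ 1 / 2).card := by
    exact_mod_cast hθ
  rw [energy, Fintype.card_fin, div_le_iff₀ hd]
  calc ∑ i, Real.sin (θ i / 2) ^ 2
      ≤ ∑ i, (1 - if Real.sin (θ i / 2) ^ 2 ≤ 1 / 2 then (1 / 2 : ℝ) else 0) := by
        refine Finset.sum_le_sum fun i _ => ?_
        split_ifs with h
        · linarith
        · linarith [Real.sin_sq_le_one (θ i / 2)]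
    _ = d - (Finset.univ.filter fun i => Real.sin (θ i / 2) ^ 2 ≤ 1 / 2).card * (1 / 2) := by
        rw [Finset.sum_sub_distrib, ← Finset.sum_filter]
        simp
    _ ≤ 3 / 4 * d := by linarith

/-- The parity character `x ↦ ∏ cos (π xⱼ) = (-1) ^ (x₁ + ⋯ + x_d)`. -/
noncomputable def parity (x : Fin d → ℤ) : ℝ := ∏ j, Real.cos (x j * Real.pi)

theorem abs_parity_le_one (x : Fin d → ℤ) : |parity x| ≤ 1 := by
  rw [parity, Finset.abs_prod]
  exact Finset.prod_le_one (fun _ _ => abs_nonneg _) fun _ _ => Real.abs_cos_le_one _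

theorem parity_comp_perm (σ : Equiv.Perm (Fin d)) (x : Fin d → ℤ) :
    parity (x ∘ σ) = parity x :=
  Equiv.prod_comp σ fun j => Real.cos (x j * Real.pi)

/-- Shifting the frequency by `(π, …, π)` multiplies the product of cosines by the parity. -/
theorem cosMean_one_eq_cosMean_parity (θ : Fin d → ℝ) :
    cosMean B (fun _ => 1) θ = cosMean B parity fun i => θ i + Real.pi := by
  refine Finset.expect_congr rfl fun x _ => ?_
  rw [one_mul, parity, ← Finset.prod_mul_distrib]
  refine Finset.prod_congr rfl fun j _ => ?_
  have h : (x j : ℝ) * θ j = x j * (θ j + Real.pi) - x j * Real.pi := by ring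
  rw [h, Real.cos_sub, Real.sin_int_mul_pi]
  ring

/-- The comparison at a frequency `θ` with at least half of its cosines nonnegative, for a weight
`w` that is `1` or the parity. There `energy θ ≤ 3 / 4`, so the term at the antipodal frequency,
which carries an arbitrary coefficient `c` in `[-1, 1]`, contributes at most `4 / n`. -/
theorem abs_cosMean_sub_cesaro_le [NeZero d] (hB : ∀ x, x ∈ B ↔ ∑ i, x i ^ 2 ≤ (n : ℤ))
    (hn : 1 ≤ n) (hd : 512 * n ≤ d) (w : (Fin d → ℤ) → ℝ) (hw1 : ∀ x, |w x| ≤ 1)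
    (hw : ∀ (σ : Equiv.Perm (Fin d)) x, w (x ∘ σ) = w x) (θ : Fin d → ℝ)
    (hθ : d ≤ 2 * (Finset.univ.filter fun i => Real.sin (θ i / 2) ^ 2 ≤ 1 / 2).card)
    (c : ℝ) (hc : |c| ≤ 1) :
    |cosMean B w θ - Finset.expect B w * cesaro n (1 - 2 * energy θ)
        - c * cesaro n (2 * energy θ - 1)|
      ≤ 1222 * (n * energy θ / (1 + (n * energy θ) ^ 2)) + 4 / n := by
  have hn0 : (0 : ℝ) < n := by exact_mod_cast hn
  have hne : B.Nonempty := ⟨0, by rw [hB]; simp⟩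
  have hu0 := energy_nonneg θ
  have hu1 := energy_le_one θ
  have hu2 := energy_le_of_half_small θ hθ
  have hε : |Finset.expect B w| ≤ 1 :=
    (Finset.abs_expect_le _ _).trans (Finset.expect_le hne fun x _ => hw1 x)
  have h1 := abs_cosMean_sub_le hB hne w hw1 θ
  have h2 := abs_cosMean_mul_le hB hn hd w hw1 hw θ hθ
  set u := energy θ with hu
  set ε := Finset.expect B w with hε'
  have h3 := abs_one_sub_cesaro_le hn hu0 hu1
  have h4 := abs_cesaro_mul_le hn hu0 hu1
  have h5 : |c * cesaro n (2 * u - 1)| ≤ 4 / n := by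
    have h6 := abs_cesaro_mul_le hn (u := 1 - u) (by linarith) (by linarith)
    rw [show 1 - 2 * (1 - u) = 2 * u - 1 by ring] at h6
    rw [abs_mul, le_div_iff₀ hn0]
    have h7 : |cesaro n (2 * u - 1)| * (n * (1 / 4)) ≤ 1 := by
      refine le_trans ?_ h6
      gcongr
      linarith
    nlinarith [abs_nonneg (cesaro n (2 * u - 1)),
      mul_nonneg (abs_nonneg (cesaro n (2 * u - 1))) hn0.le]
  refine (abs_sub _ _).trans (add_le_add ?_ h5)
  have hnu : 0 ≤ n * u := by positivity
  have h6 : |cosMean B w θ - ε * cesaro n (1 - 2 * u)| ≤ 4 * (n * u) := by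
    have e : cosMean B w θ - ε * cesaro n (1 - 2 * u)
        = (cosMean B w θ - ε) + ε * (1 - cesaro n (1 - 2 * u)) := by ring
    rw [e]
    refine (abs_add_le _ _).trans ?_
    rw [abs_mul]
    have := mul_le_of_le_one_left (abs_nonneg (1 - cesaro n (1 - 2 * u))) hε
    linarith
  have h7 : |cosMean B w θ - ε * cesaro n (1 - 2 * u)| * (n * u) ≤ 1218 := by
    have h8 : |ε * cesaro n (1 - 2 * u)| ≤ |cesaro n (1 - 2 * u)| := by
      rw [abs_mul]
      exact mul_le_of_le_one_left (abs_nonneg _) hε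
    calc |cosMean B w θ - ε * cesaro n (1 - 2 * u)| * (n * u)
        ≤ (|cosMean B w θ| + |cesaro n (1 - 2 * u)|) * (n * u) := by
          gcongr
          exact (abs_sub _ _).trans (by linarith)
      _ ≤ 1217 + 1 := by rw [add_mul]; linarith
      _ = 1218 := by norm_num
  have := le_mul_div_of_le_of_mul_le hnu h6 h7
  linarith

/-- The multiplier of the ball of radius `√n` is close to the symbol of
`n⁻¹ ∑_{k < n} (1 + ε (-1)ᵏ) Tᵏ`, with `T` the nearest neighbour walk and `ε` the mean parity of the
ball. The number `v`, which is `energy θ` or `1 - energy θ`, does not depend on the ball. -/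
theorem exists_abs_multiplier_sub_le [NeZero d] (θ : Fin d → ℝ) :
    ∃ v : ℝ, 0 ≤ v ∧ ∀ (n : ℕ) (B : Finset (Fin d → ℤ)),
      (∀ x, x ∈ B ↔ ∑ i, x i ^ 2 ≤ (n : ℤ)) → 1 ≤ n → 512 * n ≤ d →
      |cosMean B (fun _ => 1) θ - cesaro n (1 - 2 * energy θ)
          - Finset.expect B parity * cesaro n (2 * energy θ - 1)|
        ≤ 1222 * (n * v / (1 + (n * v) ^ 2)) + 4 / n := by
  by_cases hθ : d ≤ 2 * (Finset.univ.filter fun i => Real.sin (θ i / 2) ^ 2 ≤ 1 / 2).card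
  · refine ⟨energy θ, energy_nonneg θ, fun n B hB hn hd => ?_⟩
    have hne : B.Nonempty := ⟨0, by rw [hB]; simp⟩
    have h := abs_cosMean_sub_cesaro_le hB hn hd (fun _ => 1) (by simp) (by simp) θ hθ
      (Finset.expect B parity) ((Finset.abs_expect_le _ _).trans
        (Finset.expect_le hne fun x _ => abs_parity_le_one x))
    rwa [Finset.expect_const hne, one_mul] at h
  · set θ' : Fin d → ℝ := fun i => θ i + Real.pi with hθ'
    have hθ2 : d ≤ 2 * (Finset.univ.filter fun i => Real.sin (θ' i / 2) ^ 2 ≤ 1 / 2).card := by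
      have h1 := Finset.card_filter_add_card_filter_not (s := (Finset.univ : Finset (Fin d)))
          (fun i => Real.sin (θ i / 2) ^ 2 ≤ 1 / 2)
      have h2 : (Finset.univ.filter fun i => ¬ Real.sin (θ i / 2) ^ 2 ≤ 1 / 2).card
          ≤ (Finset.univ.filter fun i => Real.sin (θ' i / 2) ^ 2 ≤ 1 / 2).card := by
        refine Finset.card_le_card fun i hi => ?_
        simp only [Finset.mem_filter, Finset.mem_univ, true_and] at hi ⊢
        rw [hθ']
        simp only
        rw [show (θ i + Real.pi) / 2 = θ i / 2 + Real.pi / 2 by ring, Real.sin_add_pi_div_two]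
        linarith [Real.sin_sq_add_cos_sq (θ i / 2)]
      rw [Finset.card_univ, Fintype.card_fin] at h1
      omega
    refine ⟨energy θ', energy_nonneg θ', fun n B hB hn hd => ?_⟩
    have h := abs_cosMean_sub_cesaro_le hB hn hd parity abs_parity_le_one parity_comp_perm θ' hθ2
      1 (by simp)
    have he : energy θ' = 1 - energy θ := energy_add_pi θ
    rw [← cosMean_one_eq_cosMean_parity] at h
    rw [show 1 - 2 * energy θ = 2 * energy θ' - 1 by rw [he]; ring,
      show 2 * energy θ - 1 = 1 - 2 * energy θ' by rw [he]; ring, sub_right_comm]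
    simpa using h

end Ball

/-- Summing `(t / (1 + t²))²` over `t = 4ʲ v` by comparison with a telescoping sum. -/
theorem sum_sq_geometric_le {v : ℝ} (hv : 0 ≤ v) (J : ℕ) :
    ∑ j ∈ Finset.range J, ((4 : ℝ) ^ j * v / (1 + ((4 : ℝ) ^ j * v) ^ 2)) ^ 2 ≤ 2 := by
  -- The increments of `t ↦ 2 t / (1 + t)` along `t ↦ 4 t` dominate the summands.
  suffices h : ∑ j ∈ Finset.range J, ((4 : ℝ) ^ j * v / (1 + ((4 : ℝ) ^ j * v) ^ 2)) ^ 2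
      ≤ 2 * ((4 : ℝ) ^ J * v / (1 + (4 : ℝ) ^ J * v)) by
    have h1 : (4 : ℝ) ^ J * v / (1 + (4 : ℝ) ^ J * v) ≤ 1 :=
      (div_le_one (by positivity)).2 (by linarith)
    linarith
  induction J with
  | zero => simp; positivity
  | succ J ih =>
    rw [Finset.sum_range_succ]
    set t := (4 : ℝ) ^ J * v with ht
    have ht0 : 0 ≤ t := by positivity
    have h1 : (4 : ℝ) ^ (J + 1) * v = 4 * t := by rw [ht]; ring
    rw [h1]
    have h2 : (t / (1 + t ^ 2)) ^ 2 ≤ 2 * (4 * t / (1 + 4 * t)) - 2 * (t / (1 + t)) := by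
      have h3 : 2 * (4 * t / (1 + 4 * t)) - 2 * (t / (1 + t))
          = 6 * t / ((1 + 4 * t) * (1 + t)) := by
        field_simp
        ring
      rw [h3, div_pow, div_le_div_iff₀ (by positivity) (by positivity)]
      nlinarith [sq_nonneg (t - 1), sq_nonneg (t ^ 2 - t), mul_nonneg ht0 ht0,
        mul_nonneg ht0 (sq_nonneg (t ^ 2 - t)), mul_nonneg ht0 (sq_nonneg (t - 1)),
        pow_nonneg ht0 3, pow_nonneg ht0 5]
    linarith

theorem sum_sq_inv_four_pow_le (J : ℕ) :
    ∑ j ∈ Finset.range J, ((4 : ℝ) / 4 ^ j) ^ 2 ≤ 32 := by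
  suffices h : ∑ j ∈ Finset.range J, ((4 : ℝ) / 4 ^ j) ^ 2 ≤ 32 - 2 * (4 / 4 ^ J) ^ 2 by
    have : 0 ≤ 2 * ((4 : ℝ) / 4 ^ J) ^ 2 := by positivity
    linarith
  induction J with
  | zero => norm_num
  | succ J ih =>
    rw [Finset.sum_range_succ]
    have h1 : (4 : ℝ) / 4 ^ (J + 1) = (4 / 4 ^ J) / 4 := by rw [pow_succ]; field_simp
    rw [h1]
    nlinarith [sq_nonneg ((4 : ℝ) / 4 ^ J)]

/-! ### The maximal ergodic theorem -/

section MaximalErgodic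

open MeasureTheory

/-- A linear operator on functions on a discrete space that is positive, fixes the constants, and
preserves the total mass of finitely supported functions. -/
structure IsMarkov {G : Type*} (T : (G → ℝ) →ₗ[ℝ] (G → ℝ)) : Prop where
  mono : Monotone T
  map_one : T 1 = 1
  finite_support : ∀ f : G → ℝ, f.support.Finite → (T f).support.Finite
  tsum_eq : ∀ f : G → ℝ, f.support.Finite → ∑' x, T f x = ∑' x, f x

variable {G : Type*} {T : (G → ℝ) →ₗ[ℝ] (G → ℝ)}

/-- The partial sums `g + T g + ⋯ + T ^ (k - 1) g`. -/
def partialSum (T : (G → ℝ) →ₗ[ℝ] (G → ℝ)) (g : G → ℝ) (k : ℕ) : G → ℝ :=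
  ∑ i ∈ Finset.range k, (T ^ i) g

theorem partialSum_succ (g : G → ℝ) (k : ℕ) :
    partialSum T g (k + 1) = g + T (partialSum T g k) := by
  simp only [partialSum]
  rw [Finset.sum_range_succ', map_sum, add_comm]
  simp [pow_succ']

theorem IsMarkov.finite_support_partialSum (hT : IsMarkov T) {g : G → ℝ} (hg : g.support.Finite)
    (k : ℕ) : (partialSum T g k).support.Finite := by
  induction k with
  | zero => simp [partialSum]
  | succ k ih =>
    rw [partialSum_succ]
    exact (hg.union (hT.finite_support _ ih)).subset (Function.support_add _ _)

theorem IsMarkov.partialSum_nonneg (hT : IsMarkov T) {g : G → ℝ} (hg : 0 ≤ g) (k : ℕ) :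
    0 ≤ partialSum T g k := by
  induction k with
  | zero => simp [partialSum]
  | succ k ih =>
    rw [partialSum_succ]
    have := hT.mono ih
    rw [map_zero] at this
    exact add_nonneg hg this

/-- The maximal function of the ergodic means of `1, …, n + 1` steps. -/
noncomputable def ergodicMax (T : (G → ℝ) →ₗ[ℝ] (G → ℝ)) (g : G → ℝ) (n : ℕ) (x : G) : ℝ :=
  (Finset.range (n + 1)).sup' Finset.nonempty_range_add_one
    fun k => ((k + 1 : ℕ) : ℝ)⁻¹ * partialSum T g (k + 1) x

theorem IsMarkov.ergodicMax_nonneg (hT : IsMarkov T) {g : G → ℝ} (hg : 0 ≤ g) (n : ℕ) (x : G) :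
    0 ≤ ergodicMax T g n x :=
  (mul_nonneg (by positivity) (hT.partialSum_nonneg hg 1 x)).trans
    (Finset.le_sup' (fun k => ((k + 1 : ℕ) : ℝ)⁻¹ * partialSum T g (k + 1) x)
      (Finset.mem_range.2 n.succ_pos))

theorem IsMarkov.finite_support_ergodicMax (hT : IsMarkov T) {g : G → ℝ}
    (hg : g.support.Finite) (n : ℕ) : (Function.support (ergodicMax T g n)).Finite := by
  refine (Set.Finite.biUnion (Finset.finite_toSet (Finset.range (n + 1)))
    fun k _ => hT.finite_support_partialSum hg (k + 1)).subset fun x hx => ?_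
  by_contra h
  refine hx ?_
  simp only [Set.mem_iUnion, not_exists, Function.mem_support, not_not] at h
  obtain ⟨k, hk, hk'⟩ := Finset.exists_mem_eq_sup' (Finset.nonempty_range_add_one (n := n))
    fun k => ((k + 1 : ℕ) : ℝ)⁻¹ * partialSum T g (k + 1) x
  rw [ergodicMax, hk', h k hk, mul_zero]

/-- Hopf's maximal ergodic inequality, by Garsia's argument: the function
`F = max (0, maxₖ (partialSum T g k - k c))` satisfies `F ≤ g - c + T F` wherever it is positive. -/
theorem IsMarkov.mul_card_le_sum (hT : IsMarkov T) {g : G → ℝ}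
    (hgs : g.support.Finite) (n : ℕ) {c : ℝ} (hc : 0 ≤ c) (A : Finset G)
    (hA : ∀ x, x ∈ A ↔ c < ergodicMax T g n x) :
    c * A.card ≤ ∑ x ∈ A, g x := by
  classical
  let F : G → ℝ := fun x => (Finset.range (n + 2)).sup' Finset.nonempty_range_add_one
    fun k => partialSum T g k x - k * c
  have hF : ∀ k, k < n + 2 → ∀ x, partialSum T g k x - k * c ≤ F x := fun k hk x =>
    Finset.le_sup' (fun k => partialSum T g k x - k * c) (Finset.mem_range.2 hk)
  have hF0 : 0 ≤ F := fun x => by simpa [partialSum] using hF 0 (by omega) x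
  have hTF0 : 0 ≤ T F := by simpa using hT.mono hF0
  have hstep : ∀ x, F x ≤ (if x ∈ A then g x - c else 0) + T F x := by
    intro x
    obtain ⟨k, hk, hkF⟩ := Finset.exists_mem_eq_sup' (Finset.nonempty_range_add_one (n := n + 1))
      fun k => partialSum T g k x - k * c
    have hkF' : F x = partialSum T g k x - k * c := hkF
    rcases (hF0 x).eq_or_lt with h0 | h0
    · have h1 := hTF0 x
      split_ifs with hx
      · -- Membership in `A` makes `F` positive.
        exfalso
        rw [hA, ergodicMax, Finset.lt_sup'_iff] at hx
        obtain ⟨m, hm, hm'⟩ := hx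
        rw [lt_inv_mul_iff₀ (by positivity)] at hm'
        have h2 := hF (m + 1) (by simpa using hm) x
        rw [← h0] at h2
        simp only [Pi.zero_apply] at h2
        linarith
      · rw [← h0]; simpa using h1
    · rcases k with _ | k
      · simp [hkF', partialSum] at h0
      · have hxA : x ∈ A := by
          rw [hA, ergodicMax, Finset.lt_sup'_iff]
          refine ⟨k, by simpa using hk, ?_⟩
          rw [lt_inv_mul_iff₀ (by positivity)]
          simp only [Pi.zero_apply] at h0
          linarith
        rw [if_pos hxA, hkF', partialSum_succ]
        have h1 : T (partialSum T g k - (k * c) • 1) ≤ T F := hT.mono fun y => by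
          simpa using hF k (by simp at hk; omega) y
        have h2 := h1 x
        rw [map_sub, map_smul, hT.map_one] at h2
        simp only [Pi.sub_apply, Pi.smul_apply, Pi.one_apply, smul_eq_mul, mul_one] at h2
        push_cast
        simp only [Pi.add_apply]
        linarith
  have hFs : F.support.Finite := by
    refine (Set.Finite.biUnion (Finset.finite_toSet (Finset.range (n + 2)))
      fun k _ => hT.finite_support_partialSum hgs k).subset fun x hx => ?_
    by_contra h
    refine hx ?_
    simp only [Set.mem_iUnion, not_exists, Function.mem_support, not_not] at h
    refine le_antisymm (Finset.sup'_le _ _ fun k hk => ?_) (hF0 x)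
    rw [h k hk]
    have : 0 ≤ (k : ℝ) * c := by positivity
    linarith
  have hs1 : Summable F := summable_of_hasFiniteSupport hFs
  have hs2 : Summable (T F) := summable_of_hasFiniteSupport (hT.finite_support F hFs)
  have hs3 : Summable fun x => if x ∈ A then g x - c else 0 :=
    summable_of_ne_finset_zero (s := A) fun x hx => if_neg hx
  have h1 := Summable.tsum_le_tsum hstep hs1 (hs3.add hs2)
  rw [hs3.tsum_add hs2, hT.tsum_eq F hFs, tsum_eq_sum (s := A) fun x hx => if_neg hx] at h1
  have h2 : ∑ x ∈ A, (if x ∈ A then g x - c else 0) = ∑ x ∈ A, g x - c * A.card := by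
    rw [Finset.sum_congr rfl fun x hx => if_pos hx, Finset.sum_sub_distrib]
    simp [mul_comm]
  linarith

/-- Integrating the weak type inequality over all levels `c > 0` gives the strong type one, since
`∫ c in 0..a, c = a ^ 2 / 2`. -/
theorem sum_sq_le_of_forall_level {ι : Type*} (A : Finset ι) (a b : ι → ℝ) (ha : ∀ x, 0 ≤ a x)
    (h : ∀ c : ℝ, 0 ≤ c → c * (A.filter fun x => c < a x).card
      ≤ ∑ x ∈ A.filter fun x => c < a x, b x) :
    ∑ x ∈ A, a x ^ 2 ≤ 2 * ∑ x ∈ A, b x * a x := by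
  have hint : ∀ (x : ι) (f : ℝ → ℝ), Continuous f →
      Integrable ((Set.Ioo 0 (a x)).indicator f) := fun x f hf =>
    (integrable_indicator_iff measurableSet_Ioo).2
      ((hf.integrableOn_Icc (a := 0) (b := a x)).mono_set Set.Ioo_subset_Icc_self)
  have hval : ∀ (x : ι) (f : ℝ → ℝ),
      ∫ c, (Set.Ioo 0 (a x)).indicator f c = ∫ c in (0 : ℝ)..a x, f c := fun x f => by
    rw [integral_indicator measurableSet_Ioo, ← integral_Ioc_eq_integral_Ioo,
      intervalIntegral.integral_of_le (ha x)]
  have h1 : ∫ c, ∑ x ∈ A, (Set.Ioo 0 (a x)).indicator (fun c => c) c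
      ≤ ∫ c, ∑ x ∈ A, (Set.Ioo 0 (a x)).indicator (fun _ => b x) c := by
    refine integral_mono (integrable_finsetSum _ fun x _ => hint x (fun c => c) continuous_id)
      (integrable_finsetSum _ fun x _ => hint x _ continuous_const) fun c => ?_
    rcases le_or_gt c 0 with hc | hc
    · have hz : ∀ (x : ι) (f : ℝ → ℝ), (Set.Ioo 0 (a x)).indicator f c = 0 := fun x f =>
        Set.indicator_of_notMem (fun hx => absurd hx.1 (not_lt.2 hc)) f
      simp [hz]
    · have hz : ∀ (x : ι) (f : ℝ → ℝ),
          (Set.Ioo 0 (a x)).indicator f c = if c < a x then f c else 0 := fun x f => by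
        simp [Set.indicator_apply, hc]
      simp only [hz]
      rw [← Finset.sum_filter, ← Finset.sum_filter]
      simpa [mul_comm] using h c hc.le
  rw [integral_finsetSum _ fun x _ => hint x (fun c => c) continuous_id,
    integral_finsetSum _ fun x _ => hint x _ continuous_const] at h1
  simp only [hval, integral_id, intervalIntegral.integral_const, smul_eq_mul] at h1
  have h2 : ∑ x ∈ A, (a x ^ 2 - 0 ^ 2) / 2 = (∑ x ∈ A, a x ^ 2) / 2 := by
    rw [Finset.sum_div]; simp
  have h3 : ∑ x ∈ A, (a x - 0) * b x = ∑ x ∈ A, b x * a x :=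
    Finset.sum_congr rfl fun x _ => by ring
  rw [h2, h3] at h1
  linarith

/-- The maximal function of the ergodic means is bounded on `ℓ²`, with a constant that does not
depend on the operator. -/
theorem IsMarkov.sum_ergodicMax_sq_le (hT : IsMarkov T) {g : G → ℝ} (hg : 0 ≤ g) (S : Finset G)
    (hgS : g.support ⊆ S) (n : ℕ) (X : Finset G) :
    ∑ x ∈ X, ergodicMax T g n x ^ 2 ≤ 4 * ∑ x ∈ S, g x ^ 2 := by
  classical
  have hgs : g.support.Finite := S.finite_toSet.subset hgS
  set A := (hT.finite_support_ergodicMax hgs n).toFinset with hA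
  have hmem : ∀ x, x ∈ A ↔ ergodicMax T g n x ≠ 0 := fun x => by simp [hA]
  have h0 := hT.ergodicMax_nonneg hg n
  have h1 : ∑ x ∈ A, ergodicMax T g n x ^ 2 ≤ 2 * ∑ x ∈ A, g x * ergodicMax T g n x := by
    refine sum_sq_le_of_forall_level A _ g h0 fun c hc => ?_
    refine hT.mul_card_le_sum hgs n hc _ fun x => ?_
    rw [Finset.mem_filter, hmem]
    exact ⟨fun h => h.2, fun h => ⟨(hc.trans_lt h).ne', h⟩⟩
  have h2 : 2 * ∑ x ∈ A, g x * ergodicMax T g n x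
      ≤ 2 * ∑ x ∈ A, g x ^ 2 + (∑ x ∈ A, ergodicMax T g n x ^ 2) / 2 := by
    rw [Finset.mul_sum, Finset.mul_sum, Finset.sum_div, ← Finset.sum_add_distrib]
    exact Finset.sum_le_sum fun x _ => by
      nlinarith [sq_nonneg (2 * g x - ergodicMax T g n x)]
  have h3 : ∑ x ∈ A, g x ^ 2 ≤ ∑ x ∈ S, g x ^ 2 := by
    rw [← Finset.sum_filter_of_ne (s := A) (p := fun x => x ∈ S)]
    · exact Finset.sum_le_sum_of_subset_of_nonneg
        (fun x hx => (Finset.mem_filter.1 hx).2) fun x _ _ => sq_nonneg _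
    · intro x _ hx
      exact hgS (fun h => hx (by simp [h]))
  have h4 : ∑ x ∈ X, ergodicMax T g n x ^ 2 ≤ ∑ x ∈ A, ergodicMax T g n x ^ 2 := by
    rw [← Finset.sum_filter_of_ne (s := X) (p := fun x => x ∈ A)]
    · exact Finset.sum_le_sum_of_subset_of_nonneg
        (fun x hx => (Finset.mem_filter.1 hx).2) fun x _ _ => sq_nonneg _
    · intro x _ hx
      rw [hmem]
      exact fun h => hx (by simp [h])
  linarith

end MaximalErgodic

/-! ### Plancherel for convolution operators on the lattice -/

section Plancherel

open MeasureTheory UnitAddTorus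

variable {d : ℕ}

/-- The Fourier symbol of a finitely supported kernel on `ℤ^d`, as a homomorphism from the
convolution algebra to the continuous functions on the torus. -/
noncomputable def symbol (d : ℕ) :
    AddMonoidAlgebra ℂ (Fin d → ℤ) →ₐ[ℂ] C(UnitAddTorus (Fin d), ℂ) :=
  AddMonoidAlgebra.lift ℂ C(UnitAddTorus (Fin d), ℂ) (Fin d → ℤ)
    { toFun := fun x => mFourier x.toAdd
      map_one' := mFourier_zero
      map_mul' := fun x y => by ext ξ; exact mFourier_add }

theorem symbol_single (x : Fin d → ℤ) (c : ℂ) :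
    symbol d (AddMonoidAlgebra.single x c) = c • mFourier x := by
  simp [symbol]

theorem symbol_eq_sum (f : AddMonoidAlgebra ℂ (Fin d → ℤ)) :
    symbol d f = ∑ x ∈ f.coeff.support, f.coeff x • mFourier x := by
  simp [symbol, AddMonoidAlgebra.lift_apply, Finsupp.sum]

/-- Plancherel's theorem for trigonometric polynomials. -/
theorem exists_measure_integral_symbol_sq (d : ℕ) :
    ∃ (μ : Measure (UnitAddTorus (Fin d))) (_ : IsProbabilityMeasure μ),
      ∀ f : AddMonoidAlgebra ℂ (Fin d → ℤ),
        ∫ ξ, ‖symbol d f ξ‖ ^ 2 ∂μ = ∑ x ∈ f.coeff.support, ‖f.coeff x‖ ^ 2 := by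
  let _ : MeasureSpace UnitAddCircle := ⟨AddCircle.haarAddCircle⟩
  have : IsProbabilityMeasure (volume : Measure UnitAddCircle) :=
    inferInstanceAs (IsProbabilityMeasure AddCircle.haarAddCircle)
  refine ⟨volume, inferInstance, fun f => ?_⟩
  have h1 : ContinuousMap.toLp (E := ℂ) 2 volume ℂ (symbol d f)
      = ∑ x ∈ f.coeff.support, f.coeff x • mFourierLp (d := Fin d) 2 x := by
    rw [symbol_eq_sum, map_sum]
    simp
  have h2 : inner ℂ (ContinuousMap.toLp (E := ℂ) 2 volume ℂ (symbol d f))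
      (ContinuousMap.toLp (E := ℂ) 2 volume ℂ (symbol d f))
      = ∑ x ∈ f.coeff.support, (starRingEnd ℂ) (f.coeff x) * f.coeff x := by
    rw [h1]
    exact orthonormal_mFourier.inner_sum _ _ _
  rw [ContinuousMap.inner_toLp] at h2
  have h3 : ∀ z : ℂ, z * (starRingEnd ℂ) z = ((‖z‖ ^ 2 : ℝ) : ℂ) := fun z => by
    rw [Complex.mul_conj, Complex.normSq_eq_norm_sq]
  simp only [mul_comm ((starRingEnd ℂ) _), h3] at h2
  rw [integral_complex_ofReal, ← Complex.ofReal_sum] at h2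
  exact Complex.ofReal_injective h2

/-- A family of convolution operators is bounded on `ℓ²`, as a square function, by the supremum of
the square function of its symbols. -/
theorem sum_norm_sq_mul_le {ι : Type*} (s : Finset ι) (K : ι → AddMonoidAlgebra ℂ (Fin d → ℤ))
    {C : ℝ} (hK : ∀ ξ, ∑ j ∈ s, ‖symbol d (K j) ξ‖ ^ 2 ≤ C)
    (f : AddMonoidAlgebra ℂ (Fin d → ℤ)) (X : Finset (Fin d → ℤ)) :
    ∑ j ∈ s, ∑ x ∈ X, ‖(K j * f).coeff x‖ ^ 2 ≤ C * ∑ x ∈ f.coeff.support, ‖f.coeff x‖ ^ 2 := by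
  classical
  obtain ⟨μ, hμ, hP⟩ := exists_measure_integral_symbol_sq d
  have hint : ∀ g : AddMonoidAlgebra ℂ (Fin d → ℤ),
      Integrable (fun ξ => ‖symbol d g ξ‖ ^ 2) μ := fun g =>
    Continuous.integrable_of_hasCompactSupport (by fun_prop) (HasCompactSupport.of_compactSpace _)
  have h1 : ∀ g : AddMonoidAlgebra ℂ (Fin d → ℤ),
      ∑ x ∈ X, ‖g.coeff x‖ ^ 2 ≤ ∫ ξ, ‖symbol d g ξ‖ ^ 2 ∂μ := fun g => by
    rw [hP, ← Finset.sum_filter_of_ne (s := X) (p := fun x => x ∈ g.coeff.support)]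
    · exact Finset.sum_le_sum_of_subset_of_nonneg
        (fun x hx => (Finset.mem_filter.1 hx).2) fun x _ _ => by positivity
    · intro x _ hx
      rw [Finsupp.mem_support_iff]
      exact fun h => hx (by simp [h])
  calc ∑ j ∈ s, ∑ x ∈ X, ‖(K j * f).coeff x‖ ^ 2
      ≤ ∑ j ∈ s, ∫ ξ, ‖symbol d (K j * f) ξ‖ ^ 2 ∂μ := Finset.sum_le_sum fun j _ => h1 _
    _ = ∫ ξ, ∑ j ∈ s, ‖symbol d (K j * f) ξ‖ ^ 2 ∂μ :=
        (integral_finsetSum _ fun j _ => hint _).symm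
    _ ≤ ∫ ξ, C * ‖symbol d f ξ‖ ^ 2 ∂μ := by
        refine integral_mono (integrable_finsetSum _ fun j _ => hint _)
          ((hint f).const_mul C) fun ξ => ?_
        simp only [map_mul, ContinuousMap.mul_apply, norm_mul, mul_pow]
        rw [← Finset.sum_mul]
        exact mul_le_mul_of_nonneg_right (hK ξ) (by positivity)
    _ = C * ∑ x ∈ f.coeff.support, ‖f.coeff x‖ ^ 2 := by
        rw [integral_const_mul, hP]

end Plancherel

/-! ### Ball averages and the nearest neighbour walk as convolution operators -/

section Kernels

open UnitAddTorus

variable {d : ℕ}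

/-- The normalized indicator function of a finite set of lattice points. -/
noncomputable def ballKernel (B : Finset (Fin d → ℤ)) : AddMonoidAlgebra ℂ (Fin d → ℤ) :=
  (B.card : ℂ)⁻¹ • ∑ y ∈ B, AddMonoidAlgebra.single y 1

theorem coeff_ballKernel_mul (B : Finset (Fin d → ℤ)) (f : AddMonoidAlgebra ℂ (Fin d → ℤ))
    (x : Fin d → ℤ) :
    (ballKernel B * f).coeff x = (B.card : ℂ)⁻¹ * ∑ y ∈ B, f.coeff (x - y) := by
  rw [ballKernel, smul_mul_assoc, AddMonoidAlgebra.coeff_smul_apply, Finset.sum_mul,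
    AddMonoidAlgebra.coeff_sum, Finsupp.finsetSum_apply]
  simp [sub_eq_neg_add]

/-- The transition kernel of the nearest neighbour random walk on `ℤ^d`. -/
noncomputable def walkKernel (d : ℕ) : AddMonoidAlgebra ℂ (Fin d → ℤ) :=
  (2 * d : ℂ)⁻¹ • ∑ i, (AddMonoidAlgebra.single (Pi.single i 1) 1
    + AddMonoidAlgebra.single (-Pi.single i 1) 1)

theorem coeff_walkKernel_mul (f : AddMonoidAlgebra ℂ (Fin d → ℤ)) (x : Fin d → ℤ) :
    (walkKernel d * f).coeff x
      = (2 * d : ℂ)⁻¹ * ∑ i, (f.coeff (x - Pi.single i 1) + f.coeff (x + Pi.single i 1)) := by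
  rw [walkKernel, smul_mul_assoc, AddMonoidAlgebra.coeff_smul_apply, Finset.sum_mul,
    AddMonoidAlgebra.coeff_sum, Finsupp.finsetSum_apply]
  simp [sub_eq_neg_add, add_mul, add_comm]

/-- Every point of the torus is given by angles `θⱼ`, in which the characters are exponentials. -/
theorem exists_angles (ξ : UnitAddTorus (Fin d)) :
    ∃ θ : Fin d → ℝ, ∀ y : Fin d → ℤ,
      mFourier y ξ = ∏ j, Complex.exp ((y j * θ j : ℝ) * Complex.I) := by
  have h : ∀ j, ∃ t : ℝ, (t : UnitAddCircle) = ξ j := fun j => QuotientAddGroup.mk_surjective _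
  choose t ht using h
  refine ⟨fun j => 2 * Real.pi * t j, fun y => ?_⟩
  rw [mFourier, ContinuousMap.coe_mk]
  refine Finset.prod_congr rfl fun j _ => ?_
  rw [← ht j, fourier_coe_apply]
  congr 1
  push_cast
  ring

/-- The ball is symmetric under a change of sign of each coordinate, so its symbol is a mean of
products of cosines. -/
theorem symbol_ballKernel {n : ℕ} {B : Finset (Fin d → ℤ)}
    (hB : ∀ x, x ∈ B ↔ ∑ i, x i ^ 2 ≤ (n : ℤ)) {ξ : UnitAddTorus (Fin d)} {θ : Fin d → ℝ}
    (hθ : ∀ y : Fin d → ℤ, mFourier y ξ = ∏ j, Complex.exp ((y j * θ j : ℝ) * Complex.I)) :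
    symbol d (ballKernel B) ξ = (cosMean B (fun _ => 1) θ : ℂ) := by
  have key := sum_prod_eq_sum_prod_mean B
    (fun (j : Fin d) (y : Fin d → ℤ) => Function.update y j (-y j))
    (fun j y => Complex.exp ((y j * θ j : ℝ) * Complex.I))
    (fun j y => Complex.exp (((-y j : ℤ) * θ j : ℝ) * Complex.I))
    (fun j y hy => by
      rw [hB] at hy ⊢
      refine (Finset.sum_congr rfl fun i _ => ?_).trans_le hy
      by_cases h : i = j
      · subst h; simp
      · simp [h])
    (fun j y => by simp) (fun j y => by simp) (fun j k y h => by simp [h.symm])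
    (fun j k y h => by simp [h.symm]) Finset.univ (fun _ => 1) (fun _ _ _ => rfl)
  simp only [mul_one, ← hθ] at key
  rw [ballKernel, map_smul, map_sum, ContinuousMap.smul_apply, ContinuousMap.sum_apply]
  simp only [symbol_single, one_smul]
  rw [key, cosMean, Finset.expect_eq_sum_div_card]
  push_cast
  rw [smul_eq_mul, div_eq_inv_mul]
  congr 1
  refine Finset.sum_congr rfl fun y _ => ?_
  rw [one_mul]
  refine Finset.prod_congr rfl fun j _ => ?_
  rw [Complex.cos]
  ring_nf

theorem symbol_walkKernel [NeZero d] {ξ : UnitAddTorus (Fin d)} {θ : Fin d → ℝ}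
    (hθ : ∀ y : Fin d → ℤ, mFourier y ξ = ∏ j, Complex.exp ((y j * θ j : ℝ) * Complex.I)) :
    symbol d (walkKernel d) ξ = ((1 - 2 * energy θ : ℝ) : ℂ) := by
  have hd : (d : ℝ) ≠ 0 := by exact_mod_cast NeZero.ne d
  have h1 : ∀ (i : Fin d) (k : ℤ), mFourier (Pi.single i k : Fin d → ℤ) ξ
      = Complex.exp ((k * θ i : ℝ) * Complex.I) := fun i k => by
    rw [hθ, Finset.prod_eq_single i]
    · simp
    · intro j _ hj; simp [hj]
    · simp
  have h2 : ∀ i : Fin d, mFourier (Pi.single i 1 : Fin d → ℤ) ξ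
      + mFourier (-Pi.single i 1 : Fin d → ℤ) ξ
      = ((2 - 4 * Real.sin (θ i / 2) ^ 2 : ℝ) : ℂ) := fun i => by
    rw [← Pi.single_neg, h1, h1, show (2 - 4 * Real.sin (θ i / 2) ^ 2 : ℝ) = 2 * Real.cos (θ i) by
      rw [cos_eq_one_sub_two_mul_sin_half_sq]; ring]
    push_cast
    rw [Complex.cos]
    ring_nf
  rw [walkKernel, map_smul, map_sum, ContinuousMap.smul_apply, ContinuousMap.sum_apply]
  simp only [map_add, symbol_single, one_smul, ContinuousMap.add_apply, h2]
  rw [smul_eq_mul, ← Complex.ofReal_sum, energy, Finset.sum_sub_distrib, ← Finset.mul_sum]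
  have : (d : ℂ) ≠ 0 := by exact_mod_cast NeZero.ne d
  simp only [Finset.sum_const, Finset.card_univ, Fintype.card_fin, nsmul_eq_mul]
  push_cast
  field_simp
  ring

/-- The kernel `n⁻¹ ∑_{k < n} (1 + ε (-1)ᵏ) τᵏ`, where `τ` is the kernel of the nearest neighbour
walk. -/
noncomputable def modelKernel (d n : ℕ) (ε : ℝ) : AddMonoidAlgebra ℂ (Fin d → ℤ) :=
  (n : ℂ)⁻¹ • ∑ k ∈ Finset.range n, ((1 + ε * (-1) ^ k : ℝ) : ℂ) • walkKernel d ^ k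

theorem symbol_modelKernel [NeZero d] (n : ℕ) (ε : ℝ) {ξ : UnitAddTorus (Fin d)} {θ : Fin d → ℝ}
    (hθ : ∀ y : Fin d → ℤ, mFourier y ξ = ∏ j, Complex.exp ((y j * θ j : ℝ) * Complex.I)) :
    symbol d (modelKernel d n ε) ξ
      = ((cesaro n (1 - 2 * energy θ) + ε * cesaro n (2 * energy θ - 1) : ℝ) : ℂ) := by
  rw [modelKernel, map_smul, map_sum, ContinuousMap.smul_apply, ContinuousMap.sum_apply]
  simp only [map_smul, map_pow, ContinuousMap.smul_apply, ContinuousMap.pow_apply,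
    symbol_walkKernel hθ, smul_eq_mul]
  have h : 2 * energy θ - 1 = (-1) * (1 - 2 * energy θ) := by ring
  rw [h, cesaro, cesaro]
  norm_cast
  rw [mul_left_comm, ← mul_add, Finset.mul_sum, ← Finset.sum_add_distrib]
  push_cast
  congr 1
  refine Finset.sum_congr rfl fun k _ => ?_
  rw [mul_pow]
  ring

/-- The nearest neighbour random walk as an operator on real functions. -/
noncomputable def walk (d : ℕ) : ((Fin d → ℤ) → ℝ) →ₗ[ℝ] ((Fin d → ℤ) → ℝ) where
  toFun g x := (2 * d : ℝ)⁻¹ * ∑ i, (g (x - Pi.single i 1) + g (x + Pi.single i 1))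
  map_add' g h := by
    ext x
    simp only [Pi.add_apply, ← mul_add, ← Finset.sum_add_distrib]
    congr 1
    exact Finset.sum_congr rfl fun i _ => by ring
  map_smul' c g := by
    ext x
    simp only [Pi.smul_apply, smul_eq_mul, RingHom.id_apply, ← mul_add, ← Finset.mul_sum]
    ring

theorem walk_apply (g : (Fin d → ℤ) → ℝ) (x : Fin d → ℤ) :
    walk d g x = (2 * d : ℝ)⁻¹ * ∑ i, (g (x - Pi.single i 1) + g (x + Pi.single i 1)) := rfl

theorem isMarkov_walk [NeZero d] : IsMarkov (walk d) where
  mono g h hgh x := by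
    rw [walk_apply, walk_apply]
    exact mul_le_mul_of_nonneg_left
      (Finset.sum_le_sum fun i _ => add_le_add (hgh _) (hgh _)) (by positivity)
  map_one := by
    have hd : (d : ℝ) ≠ 0 := by exact_mod_cast NeZero.ne d
    ext x
    rw [walk_apply]
    simp
    field_simp
    norm_num
  finite_support g hg := by
    have h : ∀ v : Fin d → ℤ, (Function.support fun x => g (x + v)).Finite := fun v =>
      hg.preimage (add_left_injective v).injOn
    refine (Set.finite_iUnion fun i : Fin d =>
      (h (-Pi.single i 1)).union (h (Pi.single i 1))).subset fun x hx => ?_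
    by_contra hx'
    refine hx ?_
    simp only [Set.mem_iUnion, Set.mem_union, Function.mem_support, not_exists, not_or,
      not_not, ← sub_eq_add_neg] at hx'
    rw [walk_apply]
    simp [hx']
  tsum_eq g hg := by
    have hd : (d : ℝ) ≠ 0 := by exact_mod_cast NeZero.ne d
    have hs : Summable g := summable_of_hasFiniteSupport hg
    have h1 : ∀ v : Fin d → ℤ, Summable fun x => g (x + v) := fun v =>
      (Equiv.addRight v).summable_iff.2 hs
    have h2 : ∀ v : Fin d → ℤ, ∑' x, g (x + v) = ∑' x, g x := fun v =>
      (Equiv.addRight v).tsum_eq g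
    have h3 : ∀ i : Fin d, Summable fun x : Fin d → ℤ =>
        g (x - Pi.single i 1) + g (x + Pi.single i 1) := fun i => by
      simp only [sub_eq_add_neg]
      exact (h1 _).add (h1 _)
    have h4 : ∀ i : Fin d, ∑' x : Fin d → ℤ, (g (x - Pi.single i 1) + g (x + Pi.single i 1))
        = 2 * ∑' x, g x := fun i => by
      simp only [sub_eq_add_neg]
      rw [(h1 _).tsum_add (h1 _), h2, h2, two_mul]
    simp only [walk_apply]
    rw [tsum_mul_left, Summable.tsum_finsetSum fun i _ => h3 i]
    simp only [h4]
    simp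
    field_simp

theorem norm_coeff_walkKernel_pow_mul_le [NeZero d] (f : AddMonoidAlgebra ℂ (Fin d → ℤ)) (k : ℕ)
    (x : Fin d → ℤ) :
    ‖(walkKernel d ^ k * f).coeff x‖ ≤ ((walk d) ^ k) (fun y => ‖f.coeff y‖) x := by
  induction k generalizing x with
  | zero => simp
  | succ k ih =>
    rw [pow_succ', mul_assoc, coeff_walkKernel_mul, pow_succ', Module.End.mul_apply, walk_apply,
      norm_mul]
    have h1 : ‖(2 * d : ℂ)⁻¹‖ = (2 * d : ℝ)⁻¹ := by simp
    rw [h1]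
    refine mul_le_mul_of_nonneg_left ((norm_sum_le _ _).trans
      (Finset.sum_le_sum fun i _ => (norm_add_le _ _).trans (add_le_add (ih _) (ih _))))
      (by positivity)

/-- The model operators are dominated by the ergodic means of the walk. -/
theorem norm_coeff_modelKernel_mul_le [NeZero d] (f : AddMonoidAlgebra ℂ (Fin d → ℤ)) {n m : ℕ}
    (hn : 1 ≤ n) (hm : n ≤ m + 1) {ε : ℝ} (hε : |ε| ≤ 1) (x : Fin d → ℤ) :
    ‖(modelKernel d n ε * f).coeff x‖ ≤ 2 * ergodicMax (walk d) (fun y => ‖f.coeff y‖) m x := by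
  obtain ⟨n, rfl⟩ := Nat.exists_eq_add_of_le' hn
  set g : (Fin d → ℤ) → ℝ := fun y => ‖f.coeff y‖ with hg
  have h1 : ((n + 1 : ℕ) : ℝ)⁻¹ * partialSum (walk d) g (n + 1) x ≤ ergodicMax (walk d) g m x :=
    Finset.le_sup' (fun k => ((k + 1 : ℕ) : ℝ)⁻¹ * partialSum (walk d) g (k + 1) x)
      (Finset.mem_range.2 (by omega))
  have h2 : ‖(modelKernel d (n + 1) ε * f).coeff x‖
      ≤ ((n + 1 : ℕ) : ℝ)⁻¹ * (2 * partialSum (walk d) g (n + 1) x) := by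
    rw [modelKernel, smul_mul_assoc, AddMonoidAlgebra.coeff_smul_apply, Finset.sum_mul,
      AddMonoidAlgebra.coeff_sum, Finsupp.finsetSum_apply, smul_eq_mul, norm_mul, norm_inv,
      Complex.norm_natCast, partialSum, Finset.sum_apply, Finset.mul_sum]
    refine mul_le_mul_of_nonneg_left ((norm_sum_le _ _).trans (Finset.sum_le_sum fun k _ => ?_))
      (by positivity)
    rw [smul_mul_assoc, AddMonoidAlgebra.coeff_smul_apply, smul_eq_mul, norm_mul,
      Complex.norm_real, Real.norm_eq_abs]
    have h3 : |1 + ε * (-1) ^ k| ≤ 2 := by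
      refine (abs_add_le _ _).trans ?_
      rw [abs_mul, abs_pow, abs_neg, abs_one, one_pow, mul_one]
      linarith
    exact mul_le_mul h3 (norm_coeff_walkKernel_pow_mul_le f k x) (norm_nonneg _) (by norm_num)
  linarith

end Kernels

/-! ### The maximal function over the small scales -/

section SmallScales

open UnitAddTorus

variable {d : ℕ}

theorem mem_latticeBall_two_pow (j : ℕ) (x : Fin d → ℤ) :
    x ∈ latticeBall d (2 ^ j) ↔ ∑ i, x i ^ 2 ≤ ((4 ^ j : ℕ) : ℤ) := by
  have h1 : x ∈ latticeBall d (2 ^ j) ↔ ‖latticePoint x‖ ≤ 2 ^ j := by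
    simp [latticeBall]
  have h2 : ‖latticePoint x‖ ^ 2 = ((∑ i, x i ^ 2 : ℤ) : ℝ) := by
    rw [EuclideanSpace.norm_sq_eq]
    simp [latticePoint]
  rw [h1, ← pow_le_pow_iff_left₀ (norm_nonneg _) (by positivity) two_ne_zero, h2, ← pow_mul,
    mul_comm j 2, pow_mul]
  norm_num
  norm_cast

/-- On the scales `2 ^ j` with `512 * 4 ^ j ≤ d`, the ball averages differ from the model operators
by a bounded square function. -/
theorem sum_norm_sub_model_sq_le [NeZero d] (L : ℕ) (f : AddMonoidAlgebra ℂ (Fin d → ℤ))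
    (X : Finset (Fin d → ℤ)) :
    ∑ j ∈ (Finset.range L).filter (fun j => 512 * 4 ^ j ≤ d),
      ∑ x ∈ X, ‖((ballKernel (latticeBall d (2 ^ j))
        - modelKernel d (4 ^ j) (Finset.expect (latticeBall d (2 ^ j)) parity)) * f).coeff x‖ ^ 2
      ≤ (4 * 1222 ^ 2 + 64) * ∑ x ∈ f.coeff.support, ‖f.coeff x‖ ^ 2 := by
  refine sum_norm_sq_mul_le _ (fun j => ballKernel (latticeBall d (2 ^ j))
        - modelKernel d (4 ^ j) (Finset.expect (latticeBall d (2 ^ j)) parity)) (fun ξ => ?_) f X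
  obtain ⟨θ, hθ⟩ := exists_angles ξ
  obtain ⟨v, hv, hvle⟩ := exists_abs_multiplier_sub_le θ
  calc _ ≤ ∑ j ∈ (Finset.range L).filter (fun j => 512 * 4 ^ j ≤ d),
        (2 * 1222 ^ 2 * ((4 : ℝ) ^ j * v / (1 + ((4 : ℝ) ^ j * v) ^ 2)) ^ 2
          + 2 * ((4 : ℝ) / 4 ^ j) ^ 2) := by
        refine Finset.sum_le_sum fun j hj => ?_
        have h1 := hvle (4 ^ j) _ (mem_latticeBall_two_pow j) (Nat.one_le_pow _ _ (by norm_num))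
          (Finset.mem_filter.1 hj).2
        rw [map_sub, ContinuousMap.sub_apply, symbol_ballKernel (mem_latticeBall_two_pow j) hθ,
          symbol_modelKernel _ _ hθ, ← Complex.ofReal_sub, Complex.norm_real, Real.norm_eq_abs,
          ← sub_sub]
        push_cast at h1
        refine (pow_le_pow_left₀ (abs_nonneg _) h1 2).trans ?_
        nlinarith [sq_nonneg (1222 * ((4 : ℝ) ^ j * v / (1 + ((4 : ℝ) ^ j * v) ^ 2))
          - (4 : ℝ) / 4 ^ j)]
    _ ≤ ∑ j ∈ Finset.range L,
        (2 * 1222 ^ 2 * ((4 : ℝ) ^ j * v / (1 + ((4 : ℝ) ^ j * v) ^ 2)) ^ 2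
          + 2 * ((4 : ℝ) / 4 ^ j) ^ 2) :=
        Finset.sum_le_sum_of_subset_of_nonneg (Finset.filter_subset _ _)
          fun j _ _ => by positivity
    _ ≤ 2 * 1222 ^ 2 * 2 + 2 * 32 := by
        rw [Finset.sum_add_distrib, ← Finset.mul_sum, ← Finset.mul_sum]
        gcongr
        · exact sum_sq_geometric_le hv L
        · exact sum_sq_inv_four_pow_le L
    _ = 4 * 1222 ^ 2 + 64 := by norm_num

theorem sum_norm_ball_sq_le (s : Finset ℕ) (f : AddMonoidAlgebra ℂ (Fin d → ℤ))
    (X : Finset (Fin d → ℤ)) :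
    ∑ j ∈ s, ∑ x ∈ X, ‖(ballKernel (latticeBall d (2 ^ j)) * f).coeff x‖ ^ 2
      ≤ s.card * ∑ x ∈ f.coeff.support, ‖f.coeff x‖ ^ 2 := by
  refine sum_norm_sq_mul_le _ (fun j => ballKernel (latticeBall d (2 ^ j))) (fun ξ => ?_) f X
  obtain ⟨θ, hθ⟩ := exists_angles ξ
  calc _ ≤ ∑ _j ∈ s, (1 : ℝ) := by
        refine Finset.sum_le_sum fun j _ => ?_
        rw [symbol_ballKernel (mem_latticeBall_two_pow j) hθ, Complex.norm_real, Real.norm_eq_abs]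
        exact pow_le_one₀ (abs_nonneg _) (abs_cosMean_le_one _ (by simp) θ)
    _ = s.card := by simp

/-- The number of dyadic scales `2 ^ j` between `(d / 512) ^ (1 / 2)` and `C₀ d ^ (1 / 2)` is
bounded independently of the dimension. -/
theorem card_large_scales_le {C₀ : ℝ} {K : ℕ} (hK : 512 * C₀ ^ 2 < 4 ^ K) (L : ℕ) :
    ((Finset.range L).filter fun j =>
      (2 : ℝ) ^ j ≤ C₀ * Real.sqrt d ∧ ¬ 512 * 4 ^ j ≤ d).card ≤ K := by
  set s := (Finset.range L).filter fun j =>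
      (2 : ℝ) ^ j ≤ C₀ * Real.sqrt d ∧ ¬ 512 * 4 ^ j ≤ d with hs
  rcases s.eq_empty_or_nonempty with h | h
  · simp [h]
  · obtain ⟨i, hi, hmin⟩ := s.exists_min_image id h
    have hsub : s ⊆ Finset.Ico i (i + K) := by
      intro j hj
      rw [Finset.mem_Ico]
      refine ⟨hmin j hj, ?_⟩
      have hi' : (d : ℝ) < 512 * 4 ^ i := by
        exact_mod_cast not_le.1 (Finset.mem_filter.1 hi).2.2
      have hj' : (4 : ℝ) ^ j ≤ C₀ ^ 2 * d := by
        have h1 := pow_le_pow_left₀ (by positivity) (Finset.mem_filter.1 hj).2.1 2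
        rw [mul_pow, Real.sq_sqrt (Nat.cast_nonneg d), ← pow_mul, mul_comm j 2, pow_mul] at h1
        norm_num at h1
        exact h1
      have h2 : (4 : ℝ) ^ j < 4 ^ (i + K) := by
        calc (4 : ℝ) ^ j ≤ C₀ ^ 2 * d := hj'
          _ ≤ C₀ ^ 2 * (512 * 4 ^ i) := by gcongr
          _ = 4 ^ i * (512 * C₀ ^ 2) := by ring
          _ < 4 ^ i * 4 ^ K := by gcongr
          _ = 4 ^ (i + K) := (pow_add _ _ _).symm
      exact (pow_lt_pow_iff_right₀ (by norm_num)).1 h2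
    simpa using Finset.card_le_card hsub

theorem ballKernel_mul_coeff_eq_discreteAvg (f : (Fin d → ℤ) → ℂ) (Y : Finset (Fin d → ℤ))
    (t : ℝ) (x : Fin d → ℤ) (hY : ∀ y ∈ latticeBall d t, x - y ∈ Y) :
    (ballKernel (latticeBall d t) * ∑ y ∈ Y, AddMonoidAlgebra.single y (f y)).coeff x
      = discreteAvg t f x := by
  classical
  rw [coeff_ballKernel_mul, discreteAvg]
  congr 1
  refine Finset.sum_congr rfl fun y hy => ?_
  rw [AddMonoidAlgebra.coeff_sum, Finsupp.finsetSum_apply]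
  simp [Finsupp.single_apply, hY y hy]

/-- The `ℓ²` bound on finite sets; `Y` collects the points that influence the maximal function
on `X`. -/
theorem exists_sum_smallScaleMaximal_sq_le (C₀ : ℝ) :
    ∃ A : ℝ, 0 < A ∧ ∀ (d : ℕ), 1 ≤ d → ∀ (f : (Fin d → ℤ) → ℂ) (X : Finset (Fin d → ℤ)),
      ∃ Y : Finset (Fin d → ℤ),
        ∑ x ∈ X, smallScaleMaximal C₀ f x ^ 2 ≤ A * ∑ y ∈ Y, ‖f y‖ ^ 2 := by
  classical
  obtain ⟨K, hK⟩ := pow_unbounded_of_one_lt (512 * C₀ ^ 2) (by norm_num : (1 : ℝ) < 4)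
  refine ⟨32 + 2 * (4 * 1222 ^ 2 + 64) + K, by positivity, fun d hd f X => ?_⟩
  have : NeZero d := ⟨by omega⟩
  obtain ⟨L, hL⟩ := pow_unbounded_of_one_lt (C₀ * Real.sqrt d) (by norm_num : (1 : ℝ) < 2)
  set Y : Finset (Fin d → ℤ) := (Finset.range L).biUnion fun j =>
    X.biUnion fun x => (latticeBall d (2 ^ j)).image fun y => x - y with hY
  have hYmem : ∀ j < L, ∀ x ∈ X, ∀ y ∈ latticeBall d (2 ^ j), x - y ∈ Y := by
    intro j hj x hx y hy
    simp only [hY, Finset.mem_biUnion, Finset.mem_image, Finset.mem_range]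
    exact ⟨j, hj, x, hx, y, hy, rfl⟩
  refine ⟨Y, ?_⟩
  set F : AddMonoidAlgebra ℂ (Fin d → ℤ) := ∑ y ∈ Y, AddMonoidAlgebra.single y (f y) with hF
  have hFc : ∀ x, F.coeff x = if x ∈ Y then f x else 0 := fun x => by
    rw [hF, AddMonoidAlgebra.coeff_sum, Finsupp.finsetSum_apply]
    simp [Finsupp.single_apply]
  have hFsupp : ∑ x ∈ F.coeff.support, ‖F.coeff x‖ ^ 2 ≤ ∑ y ∈ Y, ‖f y‖ ^ 2 := by
    have hsub : F.coeff.support ⊆ Y := fun x hx => by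
      rw [Finsupp.mem_support_iff, hFc] at hx
      by_contra h
      exact hx (if_neg h)
    refine (Finset.sum_le_sum_of_subset_of_nonneg hsub fun x _ _ => by positivity).trans
      (le_of_eq (Finset.sum_congr rfl fun x hx => ?_))
    rw [hFc, if_pos hx]
  set S := ∑ x ∈ F.coeff.support, ‖F.coeff x‖ ^ 2 with hS
  set good := (Finset.range L).filter (fun j => 512 * 4 ^ j ≤ d) with hgood
  set bad := (Finset.range L).filter fun j =>
      (2 : ℝ) ^ j ≤ C₀ * Real.sqrt d ∧ ¬ 512 * 4 ^ j ≤ d with hbad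
  let P : (Fin d → ℤ) → ℝ := fun x => ∑ j ∈ good, ‖((ballKernel (latticeBall d (2 ^ j))
        - modelKernel d (4 ^ j) (Finset.expect (latticeBall d (2 ^ j)) parity)) * F).coeff x‖ ^ 2
  let Q : (Fin d → ℤ) → ℝ := fun x =>
    ∑ j ∈ bad, ‖(ballKernel (latticeBall d (2 ^ j)) * F).coeff x‖ ^ 2
  let E : (Fin d → ℤ) → ℝ := ergodicMax (walk d) (fun y => ‖F.coeff y‖) (4 ^ L)
  have hP0 : ∀ x, 0 ≤ P x := fun x => Finset.sum_nonneg fun j _ => by positivity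
  have hQ0 : ∀ x, 0 ≤ Q x := fun x => Finset.sum_nonneg fun j _ => by positivity
  have hpt : ∀ x ∈ X, smallScaleMaximal C₀ f x ^ 2 ≤ 8 * E x ^ 2 + 2 * P x + Q x := by
    intro x hx
    have h0 : 0 ≤ 8 * E x ^ 2 + 2 * P x + Q x := by
      have := hP0 x; have := hQ0 x; positivity
    have hmax : smallScaleMaximal C₀ f x ≤ Real.sqrt (8 * E x ^ 2 + 2 * P x + Q x) := by
      refine Real.iSup_le (fun N => ?_) (Real.sqrt_nonneg _)
      obtain ⟨N, ⟨j, rfl⟩, -, hN⟩ := N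
      have hjL : j < L := (pow_lt_pow_iff_right₀ (by norm_num)).1 (hN.trans_lt hL)
      apply Real.le_sqrt_of_sq_le
      simp only
      rw [← ballKernel_mul_coeff_eq_discreteAvg f Y _ x (hYmem j hjL x hx)]
      by_cases hj : 512 * 4 ^ j ≤ d
      · have hjg : j ∈ good := Finset.mem_filter.2 ⟨Finset.mem_range.2 hjL, hj⟩
        set ε := Finset.expect (latticeBall d (2 ^ j)) parity with hε
        have hne : (latticeBall d (2 ^ j)).Nonempty :=
          ⟨0, by rw [mem_latticeBall_two_pow]; simp⟩
        have hε1 : |ε| ≤ 1 := (Finset.abs_expect_le _ _).trans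
          (Finset.expect_le hne fun y _ => abs_parity_le_one y)
        have h1 : ‖(modelKernel d (4 ^ j) ε * F).coeff x‖ ≤ 2 * E x :=
          norm_coeff_modelKernel_mul_le F (Nat.one_le_pow _ _ (by norm_num))
            ((Nat.pow_le_pow_right (by norm_num) hjL.le).trans (Nat.le_succ _)) hε1 x
        have h2 : ‖((ballKernel (latticeBall d (2 ^ j)) - modelKernel d (4 ^ j) ε) * F).coeff x‖ ^ 2
            ≤ P x :=
          Finset.single_le_sum (f := fun j => ‖((ballKernel (latticeBall d (2 ^ j))
            - modelKernel d (4 ^ j) (Finset.expect (latticeBall d (2 ^ j)) parity)) * F).coeff x‖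
              ^ 2) (fun j _ => by positivity) hjg
        have h3 : ‖(ballKernel (latticeBall d (2 ^ j)) * F).coeff x‖
            ≤ ‖((ballKernel (latticeBall d (2 ^ j)) - modelKernel d (4 ^ j) ε) * F).coeff x‖
              + ‖(modelKernel d (4 ^ j) ε * F).coeff x‖ := by
          rw [sub_mul, AddMonoidAlgebra.coeff_sub]
          exact norm_le_norm_sub_add _ _
        set p := ‖((ballKernel (latticeBall d (2 ^ j)) - modelKernel d (4 ^ j) ε) * F).coeff x‖
        set q := ‖(modelKernel d (4 ^ j) ε * F).coeff x‖
        have hp0 : 0 ≤ p := norm_nonneg _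
        have hq0 : 0 ≤ q := norm_nonneg _
        calc ‖(ballKernel (latticeBall d (2 ^ j)) * F).coeff x‖ ^ 2 ≤ (p + 2 * E x) ^ 2 :=
              pow_le_pow_left₀ (norm_nonneg _) (by linarith) 2
          _ ≤ 8 * E x ^ 2 + 2 * P x + Q x := by
              nlinarith [sq_nonneg (p - 2 * E x), hQ0 x]
      · have hjb : j ∈ bad := Finset.mem_filter.2 ⟨Finset.mem_range.2 hjL, hN, hj⟩
        have h1 : ‖(ballKernel (latticeBall d (2 ^ j)) * F).coeff x‖ ^ 2 ≤ Q x :=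
          Finset.single_le_sum
            (f := fun j => ‖(ballKernel (latticeBall d (2 ^ j)) * F).coeff x‖ ^ 2)
            (fun j _ => by positivity) hjb
        have := hP0 x
        nlinarith [sq_nonneg (E x)]
    calc smallScaleMaximal C₀ f x ^ 2 ≤ Real.sqrt (8 * E x ^ 2 + 2 * P x + Q x) ^ 2 :=
          pow_le_pow_left₀ (Real.iSup_nonneg fun N => norm_nonneg _) hmax 2
      _ = _ := Real.sq_sqrt h0
  have hE : ∑ x ∈ X, E x ^ 2 ≤ 4 * S :=
    isMarkov_walk.sum_ergodicMax_sq_le (fun y => norm_nonneg _) F.coeff.support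
      (fun y hy => by simpa using hy) _ X
  have hP : ∑ x ∈ X, P x ≤ (4 * 1222 ^ 2 + 64) * S := by
    rw [Finset.sum_comm]
    exact sum_norm_sub_model_sq_le L F X
  have hS0 : 0 ≤ S := Finset.sum_nonneg fun x _ => by positivity
  have hQ : ∑ x ∈ X, Q x ≤ K * S := by
    rw [Finset.sum_comm]
    refine (sum_norm_ball_sq_le bad F X).trans (mul_le_mul_of_nonneg_right ?_ hS0)
    exact Nat.cast_le.2 (card_large_scales_le hK L)
  calc ∑ x ∈ X, smallScaleMaximal C₀ f x ^ 2
      ≤ ∑ x ∈ X, (8 * E x ^ 2 + 2 * P x + Q x) := Finset.sum_le_sum hpt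
    _ = 8 * ∑ x ∈ X, E x ^ 2 + 2 * ∑ x ∈ X, P x + ∑ x ∈ X, Q x := by
        rw [Finset.sum_add_distrib, Finset.sum_add_distrib, Finset.mul_sum, Finset.mul_sum]
    _ ≤ (32 + 2 * (4 * 1222 ^ 2 + 64) + K) * S := by linarith
    _ ≤ _ := by gcongr

end SmallScales

theorem mainTheorem3 (C₀ : ℝ) (hC₀ : 0 < C₀) :
    ∃ C : ℝ, 0 < C ∧
      ∀ (d : ℕ), 1 ≤ d → ∀ f : lp (fun _ : Fin d → ℤ => ℂ) 2,
        ∃ h : Memℓp (E := fun _ : Fin d → ℤ => ℝ) (smallScaleMaximal C₀ (f : (Fin d → ℤ) → ℂ)) 2,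
          ‖(⟨smallScaleMaximal C₀ (f : (Fin d → ℤ) → ℂ), h⟩ : lp (fun _ : Fin d → ℤ => ℝ) 2)‖
            ≤ C * ‖f‖ := by
  obtain ⟨A, hA, hmain⟩ := exists_sum_smallScaleMaximal_sq_le C₀
  refine ⟨Real.sqrt A, Real.sqrt_pos.2 hA, fun d hd f => ?_⟩
  have h2 : (2 : ENNReal).toReal = 2 := by simp
  have hsum : ∀ X : Finset (Fin d → ℤ),
      ∑ x ∈ X, ‖smallScaleMaximal C₀ (f : (Fin d → ℤ) → ℂ) x‖ ^ (2 : ENNReal).toReal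
        ≤ (Real.sqrt A * ‖f‖) ^ (2 : ENNReal).toReal := by
    intro X
    obtain ⟨Y, hY⟩ := hmain d hd f X
    have h3 := lp.sum_rpow_le_norm_rpow (p := 2) (by simp) f Y
    simp only [h2, Real.rpow_two, Real.norm_eq_abs, sq_abs] at h3 ⊢
    rw [mul_pow, Real.sq_sqrt hA.le]
    exact hY.trans (mul_le_mul_of_nonneg_left h3 hA.le)
  exact ⟨memℓp_gen' hsum, lp.norm_le_of_forall_sum_le (by simp) (by positivity) hsum⟩
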